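/- **Proposition 3.6.** Let $\mathcal M$ be a $\mathrm{II}_1$ factor, that is, an infinite-dimensional factor (a von Neumann algebra with center $\mathbb C$) admitting a weak*-continuous faithful tracial state $\tau$; $\mathcal M$ is not assumed to be separable. Put $\|x\|_2=\sqrt{\tau(x^*x)}$. Let $\mathcal U$ be a free ultrafilter on $\mathbb N$, and let $$\mathcal M^{\mathcal U}=\ell^\infty(\mathbb N,\mathcal M)\big/\{(x_j) : \lim_{j\to\mathcal U}\|x_j\|_2=0\},\qquad \tau_{\mathcal M^{\mathcal U}}\big((x_j)\big)=\lim_{j\to\mathcal U}\tau(x_j),$$ be the tracial ultrapower, which contains $\mathcal M$ as the classes of constant sequences. Recall that $\mathcal M$ has property $\Gamma$ if for every finite set $F\subset\mathcal M$ and every $\varepsilon>0$ there is a unitary $u\in\mathcal M$ with $\tau(u)=0$ and $\|xu-ux\|_2<\varepsilon$ for all $x\in F$. For $S\subset\mathcal M^{\mathcal U}$, the relative commutant of $S$ in $\mathcal M^{\mathcal U}$ is $S'\cap\mathcal M^{\mathcal U}=\{y\in\mathcal M^{\mathcal U} : ys=sy \text{ for all } s\in S\}$; it is *nontrivial* if it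 is not equal to $\mathbb C$. Then property $\Gamma$ for $\mathcal M$ is equivalent to each of the following eight conditions: 1. the relative commutant in $\mathcal M^{\mathcal U}$ of any finite set in $\mathcal M$ contains a trace zero unitary; 2. the relative commutant in $\mathcal M^{\mathcal U}$ of any finite set in $\mathcal M$ is nontrivial; 3. the relative commutant in $\mathcal M^{\mathcal U}$ of any countable set in $\mathcal M$ contains a trace zero unitary; 4. the relative commutant in $\mathcal M^{\mathcal U}$ of any countable set in $\mathcal M$ is nontrivial; 5. the relative commutant in $\mathcal M^{\mathcal U}$ of any finite set in $\mathcal M^{\mathcal U}$ contains a trace zero unitary; 6. the relative commutant in $\mathcal M^{\mathcal U}$ of any finite set in $\mathcal M^{\mathcal U}$ is nontrivial; 7. the relative commutant in $\mathcal M^{\mathcal U}$ of any countable set in $\mathcal M^{\mathcal U}$ contains a trace zero unitary; 8. the relative commutant in $\mathcal M^{\mathcal U}$ of any countable set in $\mathcal M^{\mathcal U}$ is nontrivial. -/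

import Mathlib

open Filter Topology
open scoped ComplexOrder

noncomputable section

namespace IIOne

universe u

variable {H : Type u} [NormedAddCommGroup H] [InnerProductSpace ℂ H] [CompleteSpace H]

/-- A *trace* on a von Neumann algebra `M` acting on `H`: a weak-star continuous (that is, normal)
faithful tracial state. Weak-star continuity is expressed by saying that `τ` belongs to the predual
of `M`: it is a sum of vector functionals `x ↦ ⟪ξₙ, x ηₙ⟫` with square-summable `(ξₙ)`, `(ηₙ)`. -/
structure Trace (M : VonNeumannAlgebra H) where
  /-- the underlying linear functional -/
  toLinearMap : M.toStarSubalgebra →ₗ[ℂ] ℂ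
  map_one' : toLinearMap 1 = 1
  nonneg' : ∀ x : M.toStarSubalgebra, 0 ≤ (x : H →L[ℂ] H) → 0 ≤ toLinearMap x
  tracial' : ∀ x y : M.toStarSubalgebra, toLinearMap (x * y) = toLinearMap (y * x)
  faithful' : ∀ x : M.toStarSubalgebra, toLinearMap (star x * x) = 0 → x = 0
  normal' : ∃ ξ η : ℕ → H, Summable (fun n => ‖ξ n‖ ^ 2) ∧ Summable (fun n => ‖η n‖ ^ 2) ∧
    ∀ x : M.toStarSubalgebra,
      HasSum (fun n => inner ℂ (ξ n) ((x : H →L[ℂ] H) (η n))) (toLinearMap x)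

instance (M : VonNeumannAlgebra H) : CoeFun (Trace M) (fun _ => M.toStarSubalgebra → ℂ) :=
  ⟨fun τ => τ.toLinearMap⟩

/-- `M` is a *II₁ factor*: its center consists of the scalars, it is infinite-dimensional,
and it has a trace. No separability is assumed. -/
structure IsIIOneFactor (M : VonNeumannAlgebra H) : Prop where
  center_trivial : ∀ x : H →L[ℂ] H, x ∈ M → x ∈ M.commutant → ∃ c : ℂ, x = c • 1
  infinite_dimensional : ¬ FiniteDimensional ℂ M.toStarSubalgebra
  exists_trace : Nonempty (Trace M)

variable {M : VonNeumannAlgebra H}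

/-- The `L²`-norm `‖x‖₂ = √τ(x⋆x)`. -/
def Trace.norm2 (τ : Trace M) (x : M.toStarSubalgebra) : ℝ :=
  Real.sqrt (τ (star x * x)).re

/-- Property Γ of Murray and von Neumann. -/
def HasGamma (τ : Trace M) : Prop :=
  ∀ F : Set M.toStarSubalgebra, F.Finite → ∀ ε : ℝ, 0 < ε →
    ∃ u ∈ unitary M.toStarSubalgebra, τ u = 0 ∧ ∀ x ∈ F, τ.norm2 (x * u - u * x) < ε

/-! ### Elementary estimates for the `L²`-norm -/

namespace Trace

variable (τ : Trace M)

theorem star_mul_self_nonneg (x : M.toStarSubalgebra) : 0 ≤ τ (star x * x) :=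
  τ.nonneg' _ (by
    have h : ((star x * x : M.toStarSubalgebra) : H →L[ℂ] H)
        = star (x : H →L[ℂ] H) * (x : H →L[ℂ] H) := rfl
    rw [h]
    exact _root_.star_mul_self_nonneg _)

theorem re_nonneg (x : M.toStarSubalgebra) : 0 ≤ (τ (star x * x)).re :=
  (Complex.nonneg_iff.1 (τ.star_mul_self_nonneg x)).1

theorem im_eq_zero (x : M.toStarSubalgebra) : (τ (star x * x)).im = 0 :=
  (Complex.nonneg_iff.1 (τ.star_mul_self_nonneg x)).2.symm

theorem norm2_nonneg (x : M.toStarSubalgebra) : 0 ≤ τ.norm2 x := Real.sqrt_nonneg _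

theorem norm2_sq (x : M.toStarSubalgebra) : τ.norm2 x ^ 2 = (τ (star x * x)).re :=
  Real.sq_sqrt (τ.re_nonneg x)

theorem norm2_star (x : M.toStarSubalgebra) : τ.norm2 (star x) = τ.norm2 x := by
  unfold norm2
  rw [star_star, τ.tracial']

theorem norm2_zero : τ.norm2 0 = 0 := by simp [norm2]

theorem norm2_add_sq_le (x y : M.toStarSubalgebra) :
    τ.norm2 (x + y) ^ 2 ≤ 2 * τ.norm2 x ^ 2 + 2 * τ.norm2 y ^ 2 := by
  have h := τ.re_nonneg (x - y)
  simp only [norm2_sq, star_add, star_sub, add_mul, mul_add, sub_mul, mul_sub, map_add, map_sub,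
    Complex.add_re, Complex.sub_re] at h ⊢
  linarith

theorem norm2_mul_le (a x : M.toStarSubalgebra) : τ.norm2 (a * x) ≤ ‖a‖ * τ.norm2 x := by
  have key : 0 ≤ τ (((‖a‖ ^ 2 : ℝ) : ℂ) • (star x * x) - star (a * x) * (a * x)) := by
    apply τ.nonneg'
    have h1 : ((((‖a‖ ^ 2 : ℝ) : ℂ) • (star x * x) - star (a * x) * (a * x) :
        M.toStarSubalgebra) : H →L[ℂ] H)
        = ((‖a‖ ^ 2 : ℝ) : ℂ) • (star (x : H →L[ℂ] H) * (x : H →L[ℂ] H))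
          - star ((a : H →L[ℂ] H) * x) * ((a : H →L[ℂ] H) * x) := rfl
    rw [h1, ContinuousLinearMap.nonneg_iff_isPositive, ContinuousLinearMap.isPositive_iff_complex]
    intro v
    have e : inner ℂ (((((‖a‖ ^ 2 : ℝ) : ℂ) • (star (x : H →L[ℂ] H) * (x : H →L[ℂ] H))
          - star ((a : H →L[ℂ] H) * x) * ((a : H →L[ℂ] H) * x)) : H →L[ℂ] H) v) v
        = ((‖a‖ ^ 2 * ‖(x : H →L[ℂ] H) v‖ ^ 2 - ‖(a : H →L[ℂ] H) ((x : H →L[ℂ] H) v)‖ ^ 2 : ℝ) : ℂ)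
        := by
      simp only [ContinuousLinearMap.star_eq_adjoint, sub_apply,
        smul_apply, mul_apply_eq_comp, inner_sub_left,
        inner_smul_left, ContinuousLinearMap.adjoint_inner_left, inner_self_eq_norm_sq_to_K,
        Complex.conj_ofReal]
      push_cast
      rfl
    rw [e]
    refine ⟨rfl, ?_⟩
    have h2 : ‖(a : H →L[ℂ] H) ((x : H →L[ℂ] H) v)‖ ≤ ‖a‖ * ‖(x : H →L[ℂ] H) v‖ :=
      (a : H →L[ℂ] H).le_opNorm _
    have h3 := pow_le_pow_left₀ (norm_nonneg _) h2 2
    rw [mul_pow] at h3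
    exact sub_nonneg.2 h3
  have h := (Complex.nonneg_iff.1 key).1
  rw [map_sub, map_smul, Complex.sub_re, smul_eq_mul, Complex.re_ofReal_mul, ← norm2_sq,
    ← norm2_sq, ← mul_pow] at h
  exact le_of_sq_le_sq (by linarith) (mul_nonneg (norm_nonneg _) (τ.norm2_nonneg x))
where
  le_of_sq_le_sq {p q : ℝ} (h : p ^ 2 ≤ q ^ 2) (hq : 0 ≤ q) : p ≤ q := abs_le_of_sq_le_sq' h hq |>.2

theorem map_star (x : M.toStarSubalgebra) : τ (star x) = star (τ x) := by
  have h1 := τ.im_eq_zero (1 + x)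
  have h2 := τ.im_eq_zero (1 + Complex.I • x)
  have h0 := τ.im_eq_zero x
  simp only [star_add, star_one, star_smul, add_mul, mul_add, one_mul, mul_one, smul_mul_assoc,
    mul_smul_comm, map_add, map_smul, τ.map_one', smul_eq_mul, Complex.add_im, Complex.mul_im,
    Complex.mul_re, Complex.I_re, Complex.I_im, Complex.star_def, Complex.conj_I,
    Complex.neg_re, Complex.neg_im, Complex.one_im] at h1 h2
  apply Complex.ext
  · simp only [Complex.star_def, Complex.conj_re]; linarith
  · simp only [Complex.star_def, Complex.conj_im]; linarith

theorem norm_le_norm2 (x : M.toStarSubalgebra) : ‖τ x‖ ≤ τ.norm2 x := by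
  have h := τ.re_nonneg (x - (τ x) • 1)
  simp only [star_sub, star_smul, star_one, sub_mul, mul_sub, smul_mul_assoc, mul_smul_comm,
    one_mul, mul_one, map_sub, map_smul, τ.map_one', map_star, smul_eq_mul, Complex.sub_re,
    Complex.mul_re, Complex.star_def, Complex.conj_re, Complex.conj_im] at h
  apply abs_le_of_sq_le_sq' _ (τ.norm2_nonneg x) |>.2
  rw [norm2_sq, Complex.sq_norm, Complex.normSq_apply]
  nlinarith

theorem norm2_one : τ.norm2 1 = 1 := by simp [norm2, τ.map_one']

theorem norm_le (x : M.toStarSubalgebra) : ‖τ x‖ ≤ ‖x‖ := by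
  have h := τ.norm2_mul_le x 1
  rw [mul_one, norm2_one, mul_one] at h
  exact (τ.norm_le_norm2 x).trans h

end Trace

/-! ### The tracial ultrapower -/

/-- `ℓ^∞(M)`: the ⋆-algebra of norm-bounded sequences in `M`. -/
def boundedSeq (M : VonNeumannAlgebra H) : StarSubalgebra ℂ (ℕ → M.toStarSubalgebra) where
  carrier := {x | ∃ C : ℝ, ∀ j, ‖x j‖ ≤ C}
  mul_mem' := by
    rintro x y ⟨C, hC⟩ ⟨D, hD⟩
    exact ⟨C * D, fun j => (norm_mul_le _ _).trans
      (mul_le_mul (hC j) (hD j) (norm_nonneg _) ((norm_nonneg _).trans (hC j)))⟩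
  add_mem' := by
    rintro x y ⟨C, hC⟩ ⟨D, hD⟩
    exact ⟨C + D, fun j => (norm_add_le _ _).trans (add_le_add (hC j) (hD j))⟩
  algebraMap_mem' := fun c => ⟨‖algebraMap ℂ M.toStarSubalgebra c‖, fun _ => le_rfl⟩
  star_mem' := by
    rintro x ⟨C, hC⟩
    refine ⟨C, fun j => ?_⟩
    have h : ‖star (x j)‖ = ‖x j‖ := norm_star (x j : H →L[ℂ] H)
    exact h.trans_le (hC j)

/-- The ideal of bounded sequences with `lim_{j → 𝒰} ‖x_j‖₂ = 0`. -/
def nullIdeal (τ : Trace M) (U : Ultrafilter ℕ) : Ideal (boundedSeq M) where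
  carrier := {x | Tendsto (fun j => τ.norm2 (x.1 j)) U (𝓝 0)}
  zero_mem' := by
    change Tendsto (fun _ => τ.norm2 0) _ _
    rw [τ.norm2_zero]
    exact tendsto_const_nhds
  add_mem' := by
    intro x y hx hy
    have h : Tendsto (fun j => Real.sqrt (2 * τ.norm2 (x.1 j) ^ 2 + 2 * τ.norm2 (y.1 j) ^ 2))
        U (𝓝 0) := by
      have := (((hx.pow 2).const_mul 2).add ((hy.pow 2).const_mul 2)).sqrt
      simpa using this
    exact squeeze_zero (fun j => τ.norm2_nonneg _)
      (fun j => Real.le_sqrt_of_sq_le (τ.norm2_add_sq_le _ _)) h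
  smul_mem' := by
    intro a x hx
    obtain ⟨C, hC⟩ := a.2
    have h : Tendsto (fun j => C * τ.norm2 (x.1 j)) U (𝓝 0) := by
      simpa using hx.const_mul C
    exact squeeze_zero (fun j => τ.norm2_nonneg _)
      (fun j => (τ.norm2_mul_le _ _).trans
        (mul_le_mul_of_nonneg_right (hC j) (τ.norm2_nonneg _))) h

theorem mem_nullIdeal {τ : Trace M} {U : Ultrafilter ℕ} {x : boundedSeq M} :
    x ∈ nullIdeal τ U ↔ Tendsto (fun j => τ.norm2 (x.1 j)) U (𝓝 0) := Iff.rfl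

theorem star_mem_nullIdeal {τ : Trace M} {U : Ultrafilter ℕ} {x : boundedSeq M}
    (hx : x ∈ nullIdeal τ U) : star x ∈ nullIdeal τ U := by
  have h : (fun j => τ.norm2 ((star x).1 j)) = fun j => τ.norm2 (x.1 j) :=
    funext fun j => τ.norm2_star (x.1 j)
  rw [mem_nullIdeal, h]
  exact hx

instance (τ : Trace M) (U : Ultrafilter ℕ) : (nullIdeal τ U).IsTwoSided where
  mul_mem_of_left := by
    intro a b ha
    have h := star_mem_nullIdeal
      ((nullIdeal τ U).mul_mem_left (star b) (star_mem_nullIdeal ha))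
    rwa [← star_mul, star_star] at h

/-- The tracial ultrapower `M^𝒰 = ℓ^∞(M) / {(x_j) | lim_{j → 𝒰} ‖x_j‖₂ = 0}`. -/
def Ultrapower (τ : Trace M) (U : Ultrafilter ℕ) : Type u :=
  boundedSeq M ⧸ nullIdeal τ U

namespace Ultrapower

variable (τ : Trace M) (U : Ultrafilter ℕ)

instance : Ring (Ultrapower τ U) := inferInstanceAs (Ring (boundedSeq M ⧸ nullIdeal τ U))

instance : Algebra ℂ (Ultrapower τ U) :=
  inferInstanceAs (Algebra ℂ (boundedSeq M ⧸ nullIdeal τ U))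

/-- The element of `M^𝒰` represented by a bounded sequence. -/
def mk : boundedSeq M →ₐ[ℂ] Ultrapower τ U := Ideal.Quotient.mkₐ ℂ (nullIdeal τ U)

theorem mk_surjective : Function.Surjective (mk τ U) := Ideal.Quotient.mkₐ_surjective ℂ _

theorem mk_eq_mk {x y : boundedSeq M} :
    mk τ U x = mk τ U y ↔ Tendsto (fun j => τ.norm2 (x.1 j - y.1 j)) U (𝓝 0) :=
  Ideal.Quotient.eq

/-- The adjoint on `M^𝒰`, computed on representing sequences. -/
instance : Star (Ultrapower τ U) where
  star := Quotient.lift (fun x => mk τ U (star x)) (by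
    intro x y hxy
    have h : x - y ∈ nullIdeal τ U := (Submodule.quotientRel_def _).1 hxy
    have h' : star x - star y ∈ nullIdeal τ U := by
      have e : star x - star y = star (x - y) := (star_sub x y).symm
      rw [e]
      exact star_mem_nullIdeal h
    exact Ideal.Quotient.eq.2 h')

theorem star_mk (x : boundedSeq M) : star (mk τ U x) = mk τ U (star x) := rfl

theorem mk_mul (x y : boundedSeq M) : mk τ U (x * y) = mk τ U x * mk τ U y :=
  map_mul (mk τ U) x y

theorem mk_add (x y : boundedSeq M) : mk τ U (x + y) = mk τ U x + mk τ U y :=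
  map_add (mk τ U) x y

theorem star_mul_aux (a b : Ultrapower τ U) : star (a * b) = star b * star a := by
  obtain ⟨x, rfl⟩ := mk_surjective τ U a
  obtain ⟨y, rfl⟩ := mk_surjective τ U b
  have e : star (x * y) = star y * star x := star_mul x y
  rw [star_mk, star_mk, ← mk_mul, ← mk_mul, star_mk, e]

theorem star_add_aux (a b : Ultrapower τ U) : star (a + b) = star a + star b := by
  obtain ⟨x, rfl⟩ := mk_surjective τ U a
  obtain ⟨y, rfl⟩ := mk_surjective τ U b
  have e : star (x + y) = star x + star y := star_add x y
  rw [star_mk, star_mk, ← mk_add, ← mk_add, star_mk, e]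

theorem star_star_aux (a : Ultrapower τ U) : star (star a) = a := by
  obtain ⟨x, rfl⟩ := mk_surjective τ U a
  rw [star_mk, star_mk, star_star]

instance : StarRing (Ultrapower τ U) where
  star_involutive := star_star_aux τ U
  star_mul := star_mul_aux τ U
  star_add := star_add_aux τ U

/-- Along an ultrafilter the traces of a bounded sequence converge, so the limit below is never
a default value. -/
theorem tendsto_trace (x : boundedSeq M) :
    Tendsto (fun j => τ (x.1 j)) U (𝓝 (limUnder (U : Filter ℕ) (fun j => τ (x.1 j)))) := by
  obtain ⟨C, hC⟩ := x.2
  have hK : IsCompact (Metric.closedBall (0 : ℂ) C) := isCompact_closedBall 0 C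
  obtain ⟨z, -, hz⟩ := hK.ultrafilter_le_nhds (U.map fun j => τ (x.1 j)) (by
    rw [le_principal_iff]
    change (fun j => τ (x.1 j)) ⁻¹' Metric.closedBall (0 : ℂ) C ∈ (U : Filter ℕ)
    exact Filter.univ_mem' fun j => mem_closedBall_zero_iff.2 ((τ.norm_le (x.1 j)).trans (hC j)))
  exact tendsto_nhds_limUnder ⟨z, hz⟩

/-- The trace on `M^𝒰`: `τ_{M^𝒰}((x_j)) = lim_{j → 𝒰} τ(x_j)`. -/
def trace : Ultrapower τ U → ℂ :=
  Quotient.lift (fun x : boundedSeq M => limUnder (U : Filter ℕ) (fun j => τ (x.1 j))) (by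
    intro x y hxy
    have h : x - y ∈ nullIdeal τ U := (Submodule.quotientRel_def _).1 hxy
    have h0 : Tendsto (fun j => τ ((x - y).1 j)) U (𝓝 0) :=
      squeeze_zero_norm (fun j => τ.norm_le_norm2 _) h
    have h1 := (tendsto_trace τ U x).sub (tendsto_trace τ U y)
    have h2 : (fun j => τ (x.1 j) - τ (y.1 j)) = fun j => τ ((x - y).1 j) :=
      funext fun j => (map_sub τ.toLinearMap _ _).symm
    rw [h2] at h1
    exact sub_eq_zero.1 (tendsto_nhds_unique h1 h0))

theorem trace_mk (x : boundedSeq M) :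
    Tendsto (fun j => τ (x.1 j)) U (𝓝 (trace τ U (mk τ U x))) := tendsto_trace τ U x

/-- The canonical inclusion `M ↪ M^𝒰` by constant sequences. -/
def const (a : M.toStarSubalgebra) : Ultrapower τ U :=
  mk τ U ⟨fun _ => a, ‖a‖, fun _ => le_rfl⟩

variable {τ U}

/-- The set `S ⊆ M^𝒰` contains a trace zero unitary of `M^𝒰`. -/
def ContainsTraceZeroUnitary (S : Set (Ultrapower τ U)) : Prop :=
  ∃ u ∈ S, u ∈ unitary (Ultrapower τ U) ∧ trace τ U u = 0

/-- The set `S ⊆ M^𝒰` is nontrivial: it contains an element that is not a scalar. -/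
def IsNontrivial (S : Set (Ultrapower τ U)) : Prop :=
  ∃ y ∈ S, ∀ c : ℂ, y ≠ algebraMap ℂ (Ultrapower τ U) c

end Ultrapower

end IIOne

end

/-! Property Γ gives the strongest of the eight conditions, a trace zero unitary commuting with a
countable subset of the ultrapower, by a diagonal choice along representing sequences. Every
condition implies the weakest: finite sets in M have nontrivial relative commutant in the
ultrapower. The substance is that this weakest condition implies Γ.

The difficulty is uniformity: the nonscalar element commuting with F may come arbitrarily close to a
scalar as F grows. The intermediate property `HasUniformlyNontrivialCentralElements` asks for
contractions that almost commute with F and whose `L²`-distance to their trace has a lower bound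
independent of F and ε.

This property implies Γ. A Cayley transform (`exists_cayley`) turns the contractions into unitaries
w with the moduli of τ(w) and τ(w²) at most some ρ < 1. In a factor, a weak limit of asymptotically
central elements is a scalar, so almost central contractions become independent of any fixed element
(`exists_finset_almost_independent`). Hence the traces of products of such unitaries nearly multiply
and can be made small (`exists_unitary_pow`), and a fixed point argument moves the resulting unitary
to one of trace exactly zero (`exists_trace_zero_unitary_near`).

Uniformity is obtained by a dichotomy. If some finite G₀ in M has trivial relative commutant in M,
unitaries asymptotically commuting with F and G₀ have scalar weak limits. Their products therefore
have traces tending to 0 while still almost commuting with F; the bound t < 1 on one factor may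
depend on F, since the number of factors compensates for it.

If no such G₀ exists, one works inside M. Let p be maximal among projections of trace at most 1/4
commuting with F and its adjoints. Since τ(p) < 1/2, comparison in the factor yields g with g p = 0
such that x g = 0 forces x p = 0 (`exists_left_support`). A nonzero projection q of trace at most
1/2 commuting with F, p and g cannot lie under p, so p + q(1 - p) strictly exceeds p; by maximality
its trace lies between 1/4 and 3/4. -/

noncomputable section

namespace IIOne

universe u

section

variable {H : Type u} [NormedAddCommGroup H] [InnerProductSpace ℂ H] [CompleteSpace H]
variable {M : VonNeumannAlgebra H}

/-! ### The `L²`-seminorm -/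

namespace Trace

variable (τ : Trace M)

theorem norm_star (x : M.toStarSubalgebra) : ‖star x‖ = ‖x‖ :=
  _root_.norm_star (x : H →L[ℂ] H)

theorem norm2_smul (c : ℂ) (x : M.toStarSubalgebra) : τ.norm2 (c • x) = ‖c‖ * τ.norm2 x := by
  have h : (τ (star (c • x) * (c • x))).re = ‖c‖ ^ 2 * (τ (star x * x)).re := by
    rw [star_smul, smul_mul_smul_comm, map_smul, smul_eq_mul, Complex.star_def,
      ← Complex.normSq_eq_conj_mul_self, Complex.re_ofReal_mul, Complex.normSq_eq_norm_sq]
  rw [norm2, h, Real.sqrt_mul (by positivity), Real.sqrt_sq (norm_nonneg _), norm2]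

theorem norm2_neg (x : M.toStarSubalgebra) : τ.norm2 (-x) = τ.norm2 x := by simp [norm2]

theorem norm2_sub_comm (x y : M.toStarSubalgebra) : τ.norm2 (x - y) = τ.norm2 (y - x) := by
  rw [← norm2_neg, neg_sub]

/-- The pre-inner product `⟪x, y⟫ = τ(x⋆ y)`. -/
@[reducible]
def preInner : PreInnerProductSpace.Core ℂ M.toStarSubalgebra where
  inner x y := τ (star x * y)
  conj_inner_symm x y := by
    have h := τ.map_star (star y * x)
    rw [star_mul, star_star] at h
    rw [h, starRingEnd_apply]
  re_inner_nonneg x := τ.re_nonneg x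
  add_left x y z := by simp only [star_add, add_mul, map_add]
  smul_left x y c := by
    simp only [star_smul, smul_mul_assoc, map_smul, smul_eq_mul, starRingEnd_apply]

theorem norm_map_star_mul_le (x y : M.toStarSubalgebra) :
    ‖τ (star x * y)‖ ≤ τ.norm2 x * τ.norm2 y := by
  let _ := τ.preInner
  exact InnerProductSpace.Core.norm_inner_le_norm (𝕜 := ℂ) x y

theorem norm_map_mul_le (x y : M.toStarSubalgebra) :
    ‖τ (x * y)‖ ≤ τ.norm2 x * τ.norm2 y := by
  simpa [norm2_star] using τ.norm_map_star_mul_le (star x) y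

theorem norm2_add_le (x y : M.toStarSubalgebra) :
    τ.norm2 (x + y) ≤ τ.norm2 x + τ.norm2 y := by
  have hx := τ.norm2_nonneg x
  have hy := τ.norm2_nonneg y
  refine (abs_le_of_sq_le_sq' ?_ (add_nonneg hx hy)).2
  have h1 := (Complex.re_le_norm _).trans (τ.norm_map_star_mul_le x y)
  have h2 := (Complex.re_le_norm _).trans (τ.norm_map_star_mul_le y x)
  have h3 := τ.norm2_sq x
  have h4 := τ.norm2_sq y
  rw [norm2_sq]
  simp only [star_add, add_mul, mul_add, map_add, Complex.add_re]
  nlinarith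

theorem norm2_sub_le (x y : M.toStarSubalgebra) :
    τ.norm2 (x - y) ≤ τ.norm2 x + τ.norm2 y := by
  rw [sub_eq_add_neg, ← τ.norm2_neg y]
  exact τ.norm2_add_le _ _

theorem norm2_mul_le_right (x a : M.toStarSubalgebra) : τ.norm2 (x * a) ≤ τ.norm2 x * ‖a‖ := by
  rw [← norm2_star, star_mul, mul_comm, ← τ.norm2_star x, ← norm_star a]
  exact τ.norm2_mul_le _ _

theorem norm2_le_norm (x : M.toStarSubalgebra) : τ.norm2 x ≤ ‖x‖ := by
  simpa [norm2_one] using τ.norm2_mul_le x 1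

theorem eq_zero_of_norm2_eq_zero {x : M.toStarSubalgebra} (h : τ.norm2 x = 0) : x = 0 := by
  apply τ.faithful'
  have h1 := τ.norm2_sq x
  rw [h] at h1
  exact Complex.ext (by simp [← h1]) (τ.im_eq_zero x)

theorem map_star_mul_self (x : M.toStarSubalgebra) :
    τ (star x * x) = ((τ.norm2 x ^ 2 : ℝ) : ℂ) :=
  Complex.ext (by rw [Complex.ofReal_re, norm2_sq]) (by rw [Complex.ofReal_im, im_eq_zero])

theorem map_smul' (c : ℂ) (x : M.toStarSubalgebra) : τ (c • x) = c * τ x := by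
  rw [map_smul, smul_eq_mul]

theorem map_smul_one (c : ℂ) : τ (c • (1 : M.toStarSubalgebra)) = c := by
  rw [map_smul', τ.map_one', mul_one]

theorem norm2_sub_trace_sq (x : M.toStarSubalgebra) :
    τ.norm2 (x - τ x • 1) ^ 2 = τ.norm2 x ^ 2 - ‖τ x‖ ^ 2 := by
  rw [norm2_sq, norm2_sq]
  simp only [star_sub, star_smul, star_one, sub_mul, mul_sub, smul_mul_assoc, mul_smul_comm,
    one_mul, mul_one, map_sub, map_smul, τ.map_one', map_star, smul_eq_mul, Complex.sub_re,
    Complex.mul_re, Complex.star_def, Complex.conj_re, Complex.conj_im]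
  rw [Complex.sq_norm, Complex.normSq_apply]
  ring

theorem norm2_unitary {u : M.toStarSubalgebra} (hu : u ∈ unitary M.toStarSubalgebra) :
    τ.norm2 u = 1 := by
  rw [norm2, (Unitary.mem_iff.1 hu).1, τ.map_one']
  simp

theorem norm_unitary_le {u : M.toStarSubalgebra} (hu : u ∈ unitary M.toStarSubalgebra) :
    ‖u‖ ≤ 1 := by
  have h := CStarRing.norm_star_mul_self (x := (u : H →L[ℂ] H))
  have h1 : star (u : H →L[ℂ] H) * (u : H →L[ℂ] H) = 1 :=
    congrArg Subtype.val (Unitary.mem_iff.1 hu).1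
  rw [h1] at h
  have h2 : ‖(1 : H →L[ℂ] H)‖ ≤ 1 := ContinuousLinearMap.norm_id_le
  have h3 : ‖u‖ = ‖(u : H →L[ℂ] H)‖ := rfl
  rw [h3]
  nlinarith [norm_nonneg (u : H →L[ℂ] H)]

theorem norm2_comm_mul_le (x a b : M.toStarSubalgebra) :
    τ.norm2 (x * (a * b) - (a * b) * x) ≤
      τ.norm2 (x * a - a * x) * ‖b‖ + ‖a‖ * τ.norm2 (x * b - b * x) := by
  have e : x * (a * b) - (a * b) * x = (x * a - a * x) * b + a * (x * b - b * x) := by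
    noncomm_ring
  rw [e]
  exact (τ.norm2_add_le _ _).trans
    (add_le_add (τ.norm2_mul_le_right _ _) (τ.norm2_mul_le _ _))

theorem norm2_comm_star (x a : M.toStarSubalgebra) :
    τ.norm2 (x * star a - star a * x) = τ.norm2 (star x * a - a * star x) := by
  rw [← norm2_star, star_sub, star_mul, star_mul, star_star, norm2_sub_comm]

/-- A trace is continuous along bounded, weakly convergent families. -/
theorem tendsto_of_weak {ι : Type*} {l : Filter ι} {x : ι → M.toStarSubalgebra}
    {y : M.toStarSubalgebra} {C : ℝ} (hC : ∀ i, ‖x i‖ ≤ C)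
    (h : ∀ v w : H, Tendsto (fun i => inner ℂ v ((x i : H →L[ℂ] H) w)) l
      (𝓝 (inner ℂ v ((y : H →L[ℂ] H) w)))) :
    Tendsto (fun i => τ (x i)) l (𝓝 (τ y)) := by
  obtain ⟨ξ, η, hξ, hη, hs⟩ := τ.normal'
  have e : ∀ z : M.toStarSubalgebra, τ z = ∑' n, inner ℂ (ξ n) ((z : H →L[ℂ] H) (η n)) :=
    fun z => (hs z).tsum_eq.symm
  simp only [e]
  -- Each term of the predual series converges, and Cauchy–Schwarz with the uniform bound C gives a
  -- summable majorant.
  refine tendsto_tsum_of_dominated_convergence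
    (bound := fun n => C * (‖ξ n‖ ^ 2 + ‖η n‖ ^ 2)) ((hξ.add hη).mul_left C)
    (fun n => h (ξ n) (η n)) (Eventually.of_forall fun i n => ?_)
  have h1 : ‖(x i : H →L[ℂ] H) (η n)‖ ≤ C * ‖η n‖ :=
    ((x i : H →L[ℂ] H).le_opNorm _).trans
      (mul_le_mul_of_nonneg_right (hC i) (norm_nonneg _))
  have hC0 : 0 ≤ C := (norm_nonneg _).trans (hC i)
  calc ‖inner ℂ (ξ n) ((x i : H →L[ℂ] H) (η n))‖ ≤ ‖ξ n‖ * (C * ‖η n‖) :=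
        (norm_inner_le_norm _ _).trans (mul_le_mul_of_nonneg_left h1 (norm_nonneg _))
    _ = C * (‖ξ n‖ * ‖η n‖) := by ring
    _ ≤ _ := mul_le_mul_of_nonneg_left
        (by nlinarith [sq_nonneg (‖ξ n‖ - ‖η n‖), sq_nonneg (‖ξ n‖), sq_nonneg ‖η n‖]) hC0

end Trace

/-! ### Weak limits of bounded families -/

theorem mem_of_commute_commutant {x : H →L[ℂ] H} (h : ∀ y ∈ M.commutant, y * x = x * y) :
    x ∈ M := by
  have := VonNeumannAlgebra.mem_commutant_iff.2 h
  rwa [VonNeumannAlgebra.commutant_commutant] at this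

theorem commute_of_mem_commutant {x y : H →L[ℂ] H} (hx : x ∈ M) (hy : y ∈ M.commutant) :
    x * y = y * x :=
  VonNeumannAlgebra.mem_commutant_iff.1 hy x hx

/-- A bounded family of operators has a weak limit along every ultrafilter. -/
theorem exists_weak_limit {ι : Type*} (l : Ultrafilter ι) (x : ι → H →L[ℂ] H) {C : ℝ}
    (hC : ∀ i, ‖x i‖ ≤ C) :
    ∃ y : H →L[ℂ] H, ∀ v w : H, Tendsto (fun i => inner ℂ v (x i w)) l
      (𝓝 (inner ℂ v (y w))) := by
  have hb : ∀ v w i, ‖inner ℂ (x i v) w‖ ≤ C * ‖v‖ * ‖w‖ := fun v w i =>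
    (norm_inner_le_norm _ _).trans (mul_le_mul_of_nonneg_right
      (((x i).le_opNorm v).trans (mul_le_mul_of_nonneg_right (hC i) (norm_nonneg _)))
      (norm_nonneg _))
  have key : ∀ v w, ∃ z : ℂ, Tendsto (fun i => inner ℂ (x i v) w) l (𝓝 z) := by
    intro v w
    obtain ⟨z, -, hz⟩ := (isCompact_closedBall (0 : ℂ) (C * ‖v‖ * ‖w‖)).ultrafilter_le_nhds
      (l.map fun i => inner ℂ (x i v) w) (by
        rw [le_principal_iff]
        change (fun i => inner ℂ (x i v) w) ⁻¹' _ ∈ (l : Filter ι)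
        exact Filter.univ_mem' fun i => mem_closedBall_zero_iff.2 (hb v w i))
    exact ⟨z, hz⟩
  choose B hB using key
  have hB' : ∀ v w, ‖B v w‖ ≤ C * ‖v‖ * ‖w‖ := fun v w =>
    le_of_tendsto (hB v w).norm (Eventually.of_forall (hb v w))
  -- The pointwise limits form a bounded sesquilinear form, which the Riesz representation turns
  -- into an operator.
  let B₂ : H →L⋆[ℂ] H →L[ℂ] ℂ := LinearMap.mkContinuous₂
    (LinearMap.mk₂'ₛₗ (starRingEnd ℂ) (RingHom.id ℂ) B
      (fun a b c => tendsto_nhds_unique (hB _ _) (by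
        simpa only [map_add, inner_add_left] using (hB a c).add (hB b c)))
      (fun c a b => tendsto_nhds_unique (hB _ _) (by
        simpa only [map_smul, inner_smul_left, smul_eq_mul] using (hB a b).const_mul _))
      (fun a b c => tendsto_nhds_unique (hB _ _) (by
        simpa only [inner_add_right] using (hB a b).add (hB a c)))
      (fun c a b => tendsto_nhds_unique (hB _ _) (by
        simpa only [inner_smul_right, smul_eq_mul, RingHom.id_apply] using (hB a b).const_mul _))) C hB'
  refine ⟨InnerProductSpace.continuousLinearMapOfBilin B₂, fun v w => ?_⟩
  have h1 : inner ℂ (InnerProductSpace.continuousLinearMapOfBilin B₂ w) v = B w v :=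
    InnerProductSpace.continuousLinearMapOfBilin_apply B₂ w v
  have h2 := (hB w v).star
  rw [← h1] at h2
  simpa only [RCLike.star_def, inner_conj_symm] using h2

/-- A bounded family in `M` has an `L²`-weak limit in `M` along every ultrafilter. -/
theorem Trace.exists_weak_limit (τ : Trace M) {ι : Type*} (l : Ultrafilter ι)
    (x : ι → M.toStarSubalgebra) {C : ℝ} (hC : ∀ i, ‖x i‖ ≤ C) :
    ∃ y : M.toStarSubalgebra, ∀ a, Tendsto (fun i => τ (a * x i)) l (𝓝 (τ (a * y))) := by
  obtain ⟨y, hy⟩ := IIOne.exists_weak_limit l (fun i => (x i : H →L[ℂ] H)) hC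
  have hyM : y ∈ M := by
    refine mem_of_commute_commutant fun z hz => ?_
    refine ContinuousLinearMap.ext fun w => ext_inner_left ℂ fun v => ?_
    have h1 : Tendsto (fun i => inner ℂ v ((x i : H →L[ℂ] H) (z w))) l
        (𝓝 (inner ℂ v (z (y w)))) := by
      have h2 := hy (star z v) w
      simp only [ContinuousLinearMap.star_eq_adjoint,
        ContinuousLinearMap.adjoint_inner_left] at h2
      refine h2.congr fun i => ?_
      have h3 := commute_of_mem_commutant (x i).2 hz
      exact congrArg (inner ℂ v) (DFunLike.congr_fun h3.symm w)
    exact tendsto_nhds_unique h1 (hy v (z w))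
  refine ⟨⟨y, hyM⟩, fun a => τ.tendsto_of_weak (C := ‖a‖ * C)
    (fun i => (norm_mul_le _ _).trans (mul_le_mul_of_nonneg_left (hC i) (norm_nonneg _)))
    fun v w => ?_⟩
  have h2 := hy (star (a : H →L[ℂ] H) v) w
  simp only [ContinuousLinearMap.star_eq_adjoint, ContinuousLinearMap.adjoint_inner_left] at h2
  exact h2

/-- Closedness gives completeness of M, on which Neumann series, exponentials and infinite sums in M
rely. -/
instance instIsClosedCarrier : IsClosed (M.toStarSubalgebra : Set (H →L[ℂ] H)) := by
  have h : (M.toStarSubalgebra : Set (H →L[ℂ] H)) = ⋂ y ∈ M.commutant, {x | y * x = x * y} := by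
    ext x
    simp only [Set.mem_iInter, Set.mem_ofPred_eq]
    exact ⟨fun hx y hy => (commute_of_mem_commutant hx hy).symm, mem_of_commute_commutant⟩
  rw [h]
  exact isClosed_biInter fun y _ => isClosed_eq (by fun_prop) (by fun_prop)

instance instCompleteSpaceCarrier : CompleteSpace M.toStarSubalgebra :=
  (instIsClosedCarrier (M := M)).isComplete.completeSpace_coe

end

section

/-! ### The Cayley transform -/

section Cayley

variable {A : Type*} [Ring A] {j R : A}

theorem resolvent_eq_one_add_mul (e : (1 - j) * R = 1) : R = 1 + j * R := by
  have h : R - j * R = 1 := by rw [← e]; noncomm_ring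
  rw [← h]; abel

theorem resolvent_eq_one_add_mul' (e : R * (1 - j) = 1) : R = 1 + R * j := by
  have h : R - R * j = 1 := by rw [← e]; noncomm_ring
  rw [← h]; abel

variable [Algebra ℂ A]

/-- Here R is the resolvent of j and `2R - 1` is the Cayley transform `(1 + j)(1 - j)⁻¹`. The
remainder keeps the factor `j * j` in front, so that its trace can be compared with the second order
term. -/
theorem cayley_expansion (e : (1 - j) * R = 1) :
    (2 : ℂ) • R - 1 = 1 + (2 : ℂ) • j + (2 : ℂ) • (j * j) + (2 : ℂ) • (j * j * (j * R)) := by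
  have f := resolvent_eq_one_add_mul e
  have h : R = 1 + j + j * j + j * j * (j * R) := by
    calc R = 1 + j * (1 + j * (1 + j * R)) := by rw [← f, ← f, ← f]
      _ = _ := by noncomm_ring
  nth_rewrite 1 [h]
  simp only [two_smul]
  abel

theorem cayley_sq_expansion (e : (1 - j) * R = 1) :
    ((2 : ℂ) • R - 1) * ((2 : ℂ) • R - 1) = 1 + (4 : ℂ) • j + (8 : ℂ) • (j * j)
      + (4 : ℂ) • (j * j * (j * R * (R + 1 + 1))) := by
  have f := resolvent_eq_one_add_mul e
  have h' : j * R = R - 1 := by nth_rewrite 2 [f]; abel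
  have h4 : (4 : ℂ) = 2 * 2 := by norm_num
  have h8 : (8 : ℂ) = 2 * (2 * 2) := by norm_num
  have h3 : j * j * (j * R * (R + 1 + 1)) = R * R - R - j - j * j - j * j := by
    calc j * j * (j * R * (R + 1 + 1)) = j * j * ((R - 1) * (R + 1 + 1)) := by rw [h']
      _ = j * ((j * R) * R + j * R - j - j) := by noncomm_ring
      _ = j * (R * R) - j - j * j - j * j := by rw [h']; noncomm_ring
      _ = _ := by rw [← mul_assoc, h']; noncomm_ring
  rw [h3, h4, h8]
  simp only [mul_smul, two_smul]
  noncomm_ring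

/-- Derivation rule for inverses: commutators with the Cayley transform are commutators with j
between two resolvents. -/
theorem cayley_comm (e₁ : R * (1 - j) = 1) (e₂ : (1 - j) * R = 1) (x : A) :
    x * ((2 : ℂ) • R - 1) - ((2 : ℂ) • R - 1) * x = (2 : ℂ) • (R * (x * j - j * x) * R) := by
  have h : x * R - R * x = R * (x * j - j * x) * R * (-1) * (-1) := by
    calc x * R - R * x = R * (1 - j) * x * R - R * x * ((1 - j) * R) := by
          rw [e₁, e₂, one_mul, mul_one]
      _ = _ := by noncomm_ring
  have h' : R * (x * j - j * x) * R = x * R - R * x := by rw [h]; noncomm_ring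
  rw [h']
  simp only [two_smul]
  noncomm_ring

theorem cayley_mem_unitary [StarRing A] [StarModule ℂ A] (hj : star j = -j)
    (e₁ : R * (1 - j) = 1) (e₂ : (1 - j) * R = 1) : (2 : ℂ) • R - 1 ∈ unitary A := by
  have hjR : j * R = R * j := add_left_cancel
    ((resolvent_eq_one_add_mul e₂).symm.trans (resolvent_eq_one_add_mul' e₁))
  have s1 : (1 + j) * star R = 1 := by
    have h := congrArg star e₁
    rwa [star_mul, star_sub, star_one, hj, sub_neg_eq_add] at h
  have s2 : star R * (1 + j) = 1 := by
    have h := congrArg star e₂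
    rwa [star_mul, star_sub, star_one, hj, sub_neg_eq_add] at h
  have hw : (2 : ℂ) • R - 1 = (1 + j) * R := by
    rw [add_mul, one_mul, two_smul]
    nth_rewrite 2 [resolvent_eq_one_add_mul e₂]
    abel
  have hw' : (2 : ℂ) • R - 1 = R * (1 + j) := by
    rw [hw, add_mul, mul_add, one_mul, mul_one, hjR]
  have hws : star ((2 : ℂ) • R - 1) = star R * (1 - j) := by
    rw [hw, star_mul, star_add, star_one, hj, ← sub_eq_add_neg]
  refine Unitary.mem_iff.2 ⟨?_, ?_⟩
  · rw [hws, hw]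
    calc star R * (1 - j) * ((1 + j) * R) = star R * (1 + j) * ((1 - j) * R) := by noncomm_ring
      _ = 1 := by rw [s2, e₂, mul_one]
  · rw [hws, hw']
    calc R * (1 + j) * (star R * (1 - j)) = R * ((1 + j) * star R) * (1 - j) := by noncomm_ring
      _ = 1 := by rw [s1, mul_one, e₁]

end Cayley

variable {H : Type u} [NormedAddCommGroup H] [InnerProductSpace ℂ H] [CompleteSpace H]
variable {M : VonNeumannAlgebra H}

namespace Trace

variable (τ : Trace M)

theorem norm_one_le : ‖(1 : M.toStarSubalgebra)‖ ≤ 1 := norm_unitary_le (one_mem _)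

/-- Both copies of b are measured in `L²`, one on each side of Cauchy–Schwarz. A bound by `‖b‖ ^ 2`
would not be comparable with the variance of b. -/
theorem norm_map_selfAdjoint_sq_mul_le {b : M.toStarSubalgebra} (hb : star b = b)
    (z : M.toStarSubalgebra) : ‖τ (b * b * z)‖ ≤ τ.norm2 b ^ 2 * ‖z‖ := by
  calc ‖τ (b * b * z)‖ = ‖τ (star b * (b * z))‖ := by rw [hb, mul_assoc]
    _ ≤ τ.norm2 b * τ.norm2 (b * z) := τ.norm_map_star_mul_le _ _
    _ ≤ τ.norm2 b * (τ.norm2 b * ‖z‖) :=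
        mul_le_mul_of_nonneg_left (τ.norm2_mul_le_right _ _) (τ.norm2_nonneg _)
    _ = _ := by ring

theorem exists_resolvent {j : M.toStarSubalgebra} (hj : ‖j‖ ≤ 1 / 8) :
    ∃ R, R * (1 - j) = 1 ∧ (1 - j) * R = 1 ∧ ‖R‖ ≤ 8 / 7 := by
  let R₀ := Units.oneSub j (hj.trans_lt (by norm_num))
  refine ⟨↑R₀⁻¹, R₀.inv_mul, R₀.mul_inv, ?_⟩
  have f := resolvent_eq_one_add_mul (j := j) R₀.mul_inv
  have h := norm_add_le (1 : M.toStarSubalgebra) (j * ↑R₀⁻¹)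
  rw [← f] at h
  have h1 := norm_mul_le j ↑R₀⁻¹
  have h2 := norm_one_le (M := M)
  nlinarith [norm_nonneg (↑R₀⁻¹ : M.toStarSubalgebra)]

/-- The second order term lowers the trace by `k * s`, and the remainder z may give back all but s
of it. It is used with k = 2 for w and k = 8 for w². -/
theorem norm_one_sub_add_le {s k : ℝ} {z : ℂ} (hs1 : k * s ≤ 1)
    (hz : ‖z‖ ≤ (k - 1) * s) : ‖(1 : ℂ) - ((k * s : ℝ) : ℂ) + z‖ ≤ 1 - s := by
  have h1 : ‖(1 : ℂ) - ((k * s : ℝ) : ℂ)‖ = 1 - k * s := by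
    rw [← Complex.ofReal_one, ← Complex.ofReal_sub, Complex.norm_real, Real.norm_eq_abs,
      abs_of_nonneg (by linarith)]
  calc _ ≤ ‖(1 : ℂ) - ((k * s : ℝ) : ℂ)‖ + ‖z‖ := norm_add_le _ _
    _ ≤ _ := by rw [h1]; linarith

/-- The Cayley transform of a small self-adjoint element of trace zero. -/
theorem exists_cayley {b : M.toStarSubalgebra} (hb : star b = b) (hn : ‖b‖ ≤ 1 / 8)
    (h0 : τ b = 0) :
    ∃ w ∈ unitary M.toStarSubalgebra, ‖τ w‖ ≤ 1 - τ.norm2 b ^ 2 ∧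
      ‖τ (w * w)‖ ≤ 1 - τ.norm2 b ^ 2 ∧
      ∀ x, τ.norm2 (x * w - w * x) ≤ 8 * τ.norm2 (x * b - b * x) := by
  -- Skew-adjointness of `j = i b` makes the Cayley transform unitary. The linear term has trace
  -- zero and the quadratic one has trace `-s`, with s the squared `L²`-norm of b.
  obtain ⟨j, hj⟩ : ∃ j : M.toStarSubalgebra, j = Complex.I • b := ⟨_, rfl⟩
  have hjn : ‖j‖ ≤ 1 / 8 := by rw [hj, norm_smul, Complex.norm_I, one_mul]; exact hn
  have hjs : star j = -j := by
    rw [hj, star_smul, hb, Complex.star_def, Complex.conj_I, neg_smul]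
  have hjj : j * j = -(b * b) := by
    rw [hj, smul_mul_smul_comm, Complex.I_mul_I, neg_one_smul]
  have hj0 : τ j = 0 := by rw [hj, τ.map_smul', h0, mul_zero]
  obtain ⟨R, e₁, e₂, hRn⟩ := exists_resolvent hjn
  have hjRn : ‖j * R‖ ≤ 1 / 7 := by
    have h1 := norm_mul_le j R
    nlinarith [norm_nonneg R, norm_nonneg j]
  obtain ⟨s, hs⟩ : ∃ s, s = τ.norm2 b ^ 2 := ⟨_, rfl⟩
  have hbsq : τ (b * b) = (s : ℂ) := by
    rw [hs, ← τ.map_star_mul_self, hb]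
  have hs0 : 0 ≤ s := hs ▸ sq_nonneg _
  have hs1 : s ≤ 1 / 64 := by
    have h1 := τ.norm2_le_norm b
    have h2 := τ.norm2_nonneg b
    rw [hs]; nlinarith
  rw [← hs]
  refine ⟨(2 : ℂ) • R - 1, cayley_mem_unitary hjs e₁ e₂, ?_, ?_, fun x => ?_⟩
  · have hz := τ.norm_map_selfAdjoint_sq_mul_le hb (j * R)
    have e' : τ ((2 : ℂ) • R - 1)
        = (1 : ℂ) - ((2 * s : ℝ) : ℂ) + -(2 * τ (b * b * (j * R))) := by
      rw [cayley_expansion e₂, hjj]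
      simp only [map_add, map_smul, map_neg, neg_mul, smul_eq_mul, τ.map_one', hj0, hbsq]
      push_cast
      ring
    rw [e']
    refine norm_one_sub_add_le (by linarith) ?_
    rw [norm_neg, norm_mul, Complex.norm_ofNat]
    rw [← hs] at hz
    nlinarith
  · have hz := τ.norm_map_selfAdjoint_sq_mul_le hb (j * R * (R + 1 + 1))
    have h2n : ‖R + 1 + 1‖ ≤ 4 := by
      have h1 := norm_add_le (R + 1) 1
      have h3 := norm_add_le R 1
      have h2 := norm_one_le (M := M)
      linarith
    have hzn : ‖j * R * (R + 1 + 1)‖ ≤ 1 := by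
      have h1 := norm_mul_le (j * R) (R + 1 + 1)
      nlinarith [norm_nonneg (j * R), norm_nonneg (R + 1 + 1)]
    have e' : τ (((2 : ℂ) • R - 1) * ((2 : ℂ) • R - 1))
        = (1 : ℂ) - ((8 * s : ℝ) : ℂ) + -(4 * τ (b * b * (j * R * (R + 1 + 1)))) := by
      rw [cayley_sq_expansion e₂, hjj]
      simp only [map_add, map_smul, map_neg, neg_mul, smul_eq_mul, τ.map_one', hj0, hbsq]
      push_cast
      ring
    rw [e']
    refine norm_one_sub_add_le (by linarith) ?_
    rw [norm_neg, norm_mul, Complex.norm_ofNat]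
    rw [← hs] at hz
    nlinarith
  · have e : x * j - j * x = Complex.I • (x * b - b * x) := by
      rw [hj, smul_sub, mul_smul_comm, smul_mul_assoc]
    rw [cayley_comm e₁ e₂, norm2_smul, Complex.norm_ofNat]
    have h1 := τ.norm2_mul_le_right (R * (x * j - j * x)) R
    have h2 := τ.norm2_mul_le R (x * j - j * x)
    have h3 := τ.norm2_nonneg (x * j - j * x)
    have h4 : τ.norm2 (R * (x * j - j * x)) * ‖R‖
        ≤ (8 / 7 * τ.norm2 (x * j - j * x)) * (8 / 7) :=
      mul_le_mul (h2.trans (mul_le_mul_of_nonneg_right hRn h3)) hRn (norm_nonneg _)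
        (by positivity)
    have h5 : τ.norm2 (x * j - j * x) = τ.norm2 (x * b - b * x) := by
      rw [e, norm2_smul, Complex.norm_I, one_mul]
    rw [h5] at h4 h3
    linarith

end Trace

end

/-! ### Almost independence and perturbation to trace zero -/

section

variable {H : Type u} [NormedAddCommGroup H] [InnerProductSpace ℂ H] [CompleteSpace H]
variable {M : VonNeumannAlgebra H}

namespace Trace

variable (τ : Trace M)

theorem eq_of_forall_map_mul_eq {x y : M.toStarSubalgebra}
    (h : ∀ a, τ (a * x) = τ (a * y)) : x = y := by
  refine sub_eq_zero.1 (τ.faithful' _ ?_)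
  rw [mul_sub, map_sub, h, sub_self]

/-- An `L²`-weak limit commutes with every element with which the family asymptotically
commutes. -/
theorem commute_of_weak_limit {ι : Type*} {l : Filter ι} [l.NeBot] {x : ι → M.toStarSubalgebra}
    {y g : M.toStarSubalgebra} (h : ∀ a, Tendsto (fun i => τ (a * x i)) l (𝓝 (τ (a * y))))
    (hg : Tendsto (fun i => τ.norm2 (g * x i - x i * g)) l (𝓝 0)) : g * y = y * g := by
  refine τ.eq_of_forall_map_mul_eq fun a => ?_
  have h1 : Tendsto (fun i => τ (a * (g * x i - x i * g))) l (𝓝 0) :=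
    squeeze_zero_norm (fun i => τ.norm_map_mul_le _ _) (by simpa using hg.const_mul (τ.norm2 a))
  have h2 := (h (a * g)).sub (h (g * a))
  have h3 : ∀ z, τ (a * (g * z - z * g)) = τ (a * g * z) - τ (g * a * z) := by
    intro z
    rw [mul_sub, map_sub, ← mul_assoc, ← mul_assoc, τ.tracial' (a * z), ← mul_assoc]
  simp only [h3] at h1
  have h4 := tendsto_nhds_unique h2 h1
  rw [← h3, mul_sub, map_sub] at h4
  exact sub_eq_zero.1 h4

theorem map_mul_sub_tendsto_zero {ι : Type*} {l : Filter ι} {x : ι → M.toStarSubalgebra} {c : ℂ}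
    (h : ∀ a, Tendsto (fun i => τ (a * x i)) l (𝓝 (τ (a * c • 1))))
    (z : M.toStarSubalgebra) : Tendsto (fun i => τ (z * x i) - τ z * τ (x i)) l (𝓝 0) := by
  have h1 := (h z).sub ((h 1).const_mul (τ z))
  simp only [one_mul, mul_smul_comm, mul_one, map_smul', τ.map_one'] at h1
  simpa only [mul_comm, sub_self] using h1

/-- In a factor, contractions that almost commute with suitable finitely many elements are almost
independent of a given element. -/
theorem exists_finset_almost_independent
    (hM : ∀ x : M.toStarSubalgebra, (∀ g, g * x = x * g) → ∃ c : ℂ, x = c • 1)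
    (z : M.toStarSubalgebra) {ε : ℝ} (hε : 0 < ε) :
    ∃ G : Finset M.toStarSubalgebra, ∃ η > 0, ∀ w, ‖w‖ ≤ 1 →
      (∀ g ∈ G, τ.norm2 (g * w - w * g) < η) → ‖τ (z * w) - τ z * τ w‖ < ε := by
  classical
  by_contra! hcon
  choose! w hw1 hw2 hw3 using hcon
  let η : ℕ → ℝ := fun n => 1 / ((n : ℝ) + 1)
  have hη : ∀ n, 0 < η n := fun n => by positivity
  -- Counterexamples indexed by growing finite sets and shrinking tolerances are asymptotically
  -- central, so their weak limit is a scalar c. Then `τ (z * w)` and `τ z * τ w` have the same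
  -- limit, against the lower bound ε.
  let l : Ultrafilter (Finset M.toStarSubalgebra × ℕ) := Ultrafilter.of atTop
  have hl : (l : Filter (Finset M.toStarSubalgebra × ℕ)) ≤ atTop := Ultrafilter.of_le _
  obtain ⟨y, hy⟩ := τ.exists_weak_limit l (fun i => w i.1 (η i.2)) fun i => hw1 _ _ (hη _)
  obtain ⟨c, rfl⟩ := hM y fun g => by
    refine τ.commute_of_weak_limit hy ?_
    have h1 : Tendsto (fun i : Finset M.toStarSubalgebra × ℕ => η i.2) l (𝓝 0) := by
      refine (tendsto_one_div_add_atTop_nhds_zero_nat (𝕜 := ℝ)).comp (Tendsto.mono_left ?_ hl)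
      rw [← prod_atTop_atTop_eq]
      exact tendsto_snd
    have h2 : ∀ᶠ i : Finset M.toStarSubalgebra × ℕ in l, g ∈ i.1 := by
      refine hl ?_
      filter_upwards [eventually_ge_atTop (({g} : Finset M.toStarSubalgebra), 0)] with i hi
      exact hi.1 (Finset.mem_singleton_self g)
    refine squeeze_zero' (Eventually.of_forall fun i => τ.norm2_nonneg _) ?_ h1
    filter_upwards [h2] with i hi
    exact (hw2 _ _ (hη _) g hi).le
  have h := (τ.map_mul_sub_tendsto_zero hy z).norm
  rw [norm_zero] at h
  exact absurd (ge_of_tendsto h (Eventually.of_forall fun i => hw3 _ _ (hη _))) (not_le.2 hε)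

/-- A unitary whose trace is small can be perturbed to a unitary of trace zero,
provided the trace of its square is not close to modulus one. -/
theorem exists_trace_zero_unitary_near {ε : ℝ} (hε : 0 < ε) :
    ∃ η > 0, ∀ v ∈ unitary M.toStarSubalgebra, ‖τ v‖ ≤ η → ‖τ (v * v)‖ ≤ 1 / 2 →
      ∃ u ∈ unitary M.toStarSubalgebra, τ u = 0 ∧ ‖u - v‖ < ε := by
  let _ : NormedAlgebra ℚ M.toStarSubalgebra := NormedAlgebra.restrictScalars ℚ ℂ _
  have hexp := (hasStrictFDerivAt_exp_zero (𝕂 := ℂ) (𝔸 := M.toStarSubalgebra)).isLittleO.def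
    (c := 1 / 16) (by norm_num)
  obtain ⟨r, hr, hexp⟩ := Metric.eventually_nhds_iff.1 hexp
  have hexp' : ∀ a b : M.toStarSubalgebra, ‖a‖ < r → ‖b‖ < r →
      ‖NormedSpace.exp a - NormedSpace.exp b - (a - b)‖ ≤ 1 / 16 * ‖a - b‖ := by
    intro a b ha hb
    have := @hexp (a, b) (by rw [Prod.dist_eq]; simpa using ⟨ha, hb⟩)
    simpa using this
  let ρ : ℝ := min (r / 4) (ε / 4)
  have hρ : 0 < ρ := by positivity
  have hρr : 2 * ρ < r := by have : ρ ≤ r / 4 := min_le_left _ _; linarith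
  have hρε : 4 * ρ ≤ ε := by have : ρ ≤ ε / 4 := min_le_right _ _; linarith
  refine ⟨ρ / 4, by positivity, fun v hv hv1 hv2 => ?_⟩
  have hvn := norm_unitary_le hv
  -- The unitary is sought as `v * exp (A c)` with `A c` skew-adjoint. To first order its trace is
  -- `τ v - c + conj c * τ (v * v)`, and the bound 1/2 on the last coefficient makes this solvable
  -- for c.
  let A : ℂ → M.toStarSubalgebra := fun c => (starRingEnd ℂ c) • v - c • star v
  have hA0 : A 0 = 0 := by simp [A]
  have hAsub : ∀ c c', A c - A c' = A (c - c') := fun c c' => by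
    simp only [A, map_sub, sub_smul]; abel
  have hAn : ∀ c, ‖A c‖ ≤ 2 * ‖c‖ := by
    intro c
    have h1 := norm_sub_le ((starRingEnd ℂ c) • v) (c • star v)
    rw [norm_smul, norm_smul, norm_star, RCLike.norm_conj] at h1
    have h2 := mul_le_mul_of_nonneg_left hvn (norm_nonneg c)
    change ‖A c‖ ≤ _ at h1
    linarith
  have hAskew : ∀ c, A c ∈ skewAdjoint M.toStarSubalgebra := by
    intro c
    rw [skewAdjoint.mem_iff]
    simp [A]
  have hvA : ∀ c, τ (v * A c) = (starRingEnd ℂ c) * τ (v * v) - c := by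
    intro c
    simp only [A, mul_sub, mul_smul_comm, map_sub, map_smul', (Unitary.mem_iff.1 hv).2,
      τ.map_one', mul_one]
  let Φ : ℂ → ℂ := fun c => c + τ (v * NormedSpace.exp (A c))
  -- The constant is 5/8 = 1/2 + 2 · 1/16: the bound on `τ (v * v)`, plus the exponential's error
  -- 1/16 times `‖A c‖ ≤ 2 ‖c‖`.
  have hΦ : ∀ c c', ‖c‖ ≤ ρ → ‖c'‖ ≤ ρ → ‖Φ c - Φ c'‖ ≤ 5 / 8 * ‖c - c'‖ := by
    intro c c' hc hc'
    have e : Φ c - Φ c' = starRingEnd ℂ (c - c') * τ (v * v)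
        + τ (v * (NormedSpace.exp (A c) - NormedSpace.exp (A c') - (A c - A c'))) := by
      rw [hAsub, mul_sub v, mul_sub v, map_sub τ.toLinearMap, map_sub τ.toLinearMap, hvA]
      simp only [Φ]
      ring
    have h1 := hexp' (A c) (A c') (by linarith [hAn c]) (by linarith [hAn c'])
    rw [hAsub] at h1
    have h2 := hAn (c - c')
    have h3 := (τ.norm_le _).trans (norm_mul_le v
      (NormedSpace.exp (A c) - NormedSpace.exp (A c') - A (c - c')))
    have h4 := mul_le_mul_of_nonneg_right hvn
      (norm_nonneg (NormedSpace.exp (A c) - NormedSpace.exp (A c') - A (c - c')))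
    rw [e]
    refine (norm_add_le _ _).trans ?_
    rw [norm_mul, RCLike.norm_conj, hAsub]
    have h5 := mul_le_mul_of_nonneg_left hv2 (norm_nonneg (c - c'))
    linarith
  have hΦ0 : Φ 0 = τ v := by simp [Φ, hA0]
  have hmaps : Set.MapsTo Φ (Metric.closedBall 0 ρ) (Metric.closedBall 0 ρ) := by
    intro c hc
    rw [mem_closedBall_zero_iff] at hc ⊢
    have h1 := hΦ c 0 hc (by simpa using hρ.le)
    rw [hΦ0, sub_zero] at h1
    have h2 := norm_add_le (Φ c - τ v) (τ v)
    rw [sub_add_cancel] at h2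
    linarith
  have hcontr : ContractingWith (5 / 8) (hmaps.restrict Φ (Metric.closedBall 0 ρ) (Metric.closedBall 0 ρ)) := by
    refine ⟨by rw [div_lt_one] <;> norm_num, LipschitzWith.of_dist_le_mul fun c c' => ?_⟩
    have := hΦ c c' (mem_closedBall_zero_iff.1 c.2) (mem_closedBall_zero_iff.1 c'.2)
    rw [Subtype.dist_eq, Subtype.dist_eq, dist_eq_norm, dist_eq_norm]
    simpa using this
  obtain ⟨c, hc, hfix, -⟩ := hcontr.exists_fixedPoint' Metric.isClosed_closedBall.isComplete hmaps
    (x := 0) (by simpa using hρ.le) (edist_ne_top _ _)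
  rw [mem_closedBall_zero_iff] at hc
  refine ⟨v * NormedSpace.exp (A c),
    mul_mem hv (NormedSpace.exp_mem_unitary_of_mem_skewAdjoint (hAskew c)), ?_, ?_⟩
  -- A fixed point of `Φ` is exactly a parameter at which the trace vanishes.
  · have h : c + τ (v * NormedSpace.exp (A c)) = c := hfix
    simpa using h
  · have h1 := hexp' (A c) 0 (by linarith [hAn c]) (by simpa using hr)
    rw [NormedSpace.exp_zero, sub_zero] at h1
    have h2 := norm_add_le (NormedSpace.exp (A c) - 1 - A c) (A c)
    rw [sub_add_cancel] at h2
    have h3 := hAn c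
    have e : v * NormedSpace.exp (A c) - v = v * (NormedSpace.exp (A c) - 1) := by
      rw [mul_sub, mul_one]
    rw [e]
    have h4 := norm_mul_le v (NormedSpace.exp (A c) - 1)
    have h5 := mul_le_mul_of_nonneg_right hvn (norm_nonneg (NormedSpace.exp (A c) - 1))
    linarith

end Trace

end

/-! ### From uniformly nontrivial almost central elements to property Γ -/

section

variable {H : Type u} [NormedAddCommGroup H] [InnerProductSpace ℂ H] [CompleteSpace H]
variable {M : VonNeumannAlgebra H}

namespace Trace

variable (τ : Trace M)

theorem norm2_comm_smul (c : ℂ) (x a : M.toStarSubalgebra) :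
    τ.norm2 (x * (c • a) - (c • a) * x) = ‖c‖ * τ.norm2 (x * a - a * x) := by
  rw [mul_smul_comm, smul_mul_assoc, ← smul_sub, norm2_smul]

theorem norm2_comm_sub_smul_one (c : ℂ) (x a : M.toStarSubalgebra) :
    x * (a - c • 1) - (a - c • 1) * x = x * a - a * x := by
  rw [mul_sub, sub_mul, mul_smul_comm, smul_mul_assoc, mul_one, one_mul]
  abel

theorem norm2_comm_add_le (x a b : M.toStarSubalgebra) :
    τ.norm2 (x * (a + b) - (a + b) * x) ≤
      τ.norm2 (x * a - a * x) + τ.norm2 (x * b - b * x) := by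
  have e : x * (a + b) - (a + b) * x = (x * a - a * x) + (x * b - b * x) := by noncomm_ring
  rw [e]
  exact τ.norm2_add_le _ _

theorem norm2_sub_smul_one_le (x : M.toStarSubalgebra) (c d : ℂ) :
    τ.norm2 (x - d • 1) ≤ τ.norm2 (x - c • 1) + ‖c - d‖ := by
  have e : x - d • 1 = (x - c • 1) + (c - d) • 1 := by rw [sub_smul]; abel
  have h := τ.norm2_add_le (x - c • 1) ((c - d) • 1)
  rwa [← e, norm2_smul _ (c - d), norm2_one, mul_one] at h

theorem norm2_smul_sub_trace (c : ℂ) (x : M.toStarSubalgebra) :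
    τ.norm2 (c • x - τ (c • x) • 1) = ‖c‖ * τ.norm2 (x - τ x • 1) := by
  rw [map_smul', mul_smul, ← smul_sub, norm2_smul]

/-- The centered real or imaginary part of a contraction retains half of its variance. -/
theorem exists_selfAdjoint_of_contraction {a : M.toStarSubalgebra} (ha : ‖a‖ ≤ 1) :
    ∃ h : M.toStarSubalgebra, star h = h ∧ ‖h‖ ≤ 1 ∧
      τ.norm2 (a - τ a • 1) / 2 ≤ τ.norm2 (h - τ h • 1) ∧
      ∀ x, τ.norm2 (x * h - h * x) ≤
        τ.norm2 (x * a - a * x) + τ.norm2 (star x * a - a * star x) := by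
  have hi : ‖(-Complex.I / 2 : ℂ)‖ = 1 / 2 := by simp
  have h2 : ‖(1 / 2 : ℂ)‖ = 1 / 2 := by simp
  obtain ⟨h₁, e₁⟩ : ∃ h₁ : M.toStarSubalgebra, h₁ = (1 / 2 : ℂ) • (a + star a) := ⟨_, rfl⟩
  obtain ⟨h₂, e₂⟩ : ∃ h₂ : M.toStarSubalgebra, h₂ = (-Complex.I / 2) • (a + -star a) :=
    ⟨_, rfl⟩
  have hsum : a = h₁ + Complex.I • h₂ := by
    have hI : Complex.I * (-Complex.I / 2) = 1 / 2 := by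
      have := Complex.I_mul_I
      linear_combination (-1 / 2) * this
    rw [e₁, e₂, smul_smul, hI, ← smul_add]
    have : a + star a + (a + -star a) = (2 : ℂ) • a := by rw [two_smul]; abel
    rw [this, smul_smul]
    norm_num
  have hs₁ : star h₁ = h₁ := by
    rw [e₁, star_smul, star_add, star_star, add_comm]
    congr 1
    simp
  have hs₂ : star h₂ = h₂ := by
    have hc : star (-Complex.I / 2 : ℂ) = -(-Complex.I / 2) := by simp [neg_div]
    rw [e₂, star_smul, star_add, star_neg, star_star, hc, neg_smul, ← smul_neg]
    congr 1
    abel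
  have hn₁ : ‖h₁‖ ≤ 1 := by
    rw [e₁, norm_smul, h2]
    have := norm_add_le a (star a)
    rw [norm_star] at this
    linarith
  have hn₂ : ‖h₂‖ ≤ 1 := by
    rw [e₂, norm_smul, hi]
    have := norm_add_le a (-star a)
    rw [norm_neg, norm_star] at this
    linarith
  have hc₁ : ∀ x, τ.norm2 (x * h₁ - h₁ * x) ≤
      τ.norm2 (x * a - a * x) + τ.norm2 (star x * a - a * star x) := by
    intro x
    have h := τ.norm2_comm_add_le x a (star a)
    rw [norm2_comm_star] at h
    rw [e₁, norm2_comm_smul, h2]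
    linarith [τ.norm2_nonneg (x * a - a * x), τ.norm2_nonneg (star x * a - a * star x)]
  have hc₂ : ∀ x, τ.norm2 (x * h₂ - h₂ * x) ≤
      τ.norm2 (x * a - a * x) + τ.norm2 (star x * a - a * star x) := by
    intro x
    have h := τ.norm2_comm_add_le x a (-star a)
    have e : x * -star a - -star a * x = -(x * star a - star a * x) := by noncomm_ring
    rw [e, norm2_neg, norm2_comm_star] at h
    rw [e₂, norm2_comm_smul, hi]
    linarith [τ.norm2_nonneg (x * a - a * x), τ.norm2_nonneg (star x * a - a * star x)]
  have hv : τ.norm2 (a - τ a • 1) ≤ τ.norm2 (h₁ - τ h₁ • 1) + τ.norm2 (h₂ - τ h₂ • 1) := by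
    have e : a - τ a • 1 = (h₁ - τ h₁ • 1) + Complex.I • (h₂ - τ h₂ • 1) := by
      have ht : τ a = τ h₁ + Complex.I * τ h₂ := by
        nth_rewrite 1 [hsum]
        rw [map_add, map_smul']
      rw [ht, smul_sub, smul_smul, add_smul]
      nth_rewrite 1 [hsum]
      abel
    have h := τ.norm2_add_le (h₁ - τ h₁ • 1) (Complex.I • (h₂ - τ h₂ • 1))
    rwa [norm2_smul, Complex.norm_I, one_mul, ← e] at h
  by_cases hle : τ.norm2 (h₂ - τ h₂ • 1) ≤ τ.norm2 (h₁ - τ h₁ • 1)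
  · exact ⟨h₁, hs₁, hn₁, by linarith, hc₁⟩
  · exact ⟨h₂, hs₂, hn₂, by linarith, hc₂⟩

/-- A contraction with positive variance yields a unitary whose trace has modulus less than one,
with control over commutators. -/
theorem exists_unitary_of_contraction {a : M.toStarSubalgebra} (ha : ‖a‖ ≤ 1) :
    ∃ w ∈ unitary M.toStarSubalgebra,
      ‖τ w‖ ≤ 1 - (τ.norm2 (a - τ a • 1) / 32) ^ 2 ∧
      ‖τ (w * w)‖ ≤ 1 - (τ.norm2 (a - τ a • 1) / 32) ^ 2 ∧
      ∀ x, τ.norm2 (x * w - w * x) ≤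
        τ.norm2 (x * a - a * x) + τ.norm2 (star x * a - a * star x) := by
  obtain ⟨h, hs, hn, hv, hc⟩ := τ.exists_selfAdjoint_of_contraction ha
  have hr : ‖(1 / 16 : ℂ)‖ = 1 / 16 := by simp
  have hst : star (τ h) = τ h := by rw [← map_star, hs]
  have hb : star ((1 / 16 : ℂ) • (h - τ h • 1)) = (1 / 16 : ℂ) • (h - τ h • 1) := by
    rw [star_smul, star_sub, star_smul, star_one, hs, hst]
    congr 1
    simp
  -- Centering h gives norm at most 2, so the factor 1/16 reaches the range of the Cayley estimate.
  -- Together with the factor 1/2 lost in passing to h, it produces the 32 in the statement.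
  have hbn : ‖(1 / 16 : ℂ) • (h - τ h • 1)‖ ≤ 1 / 8 := by
    rw [norm_smul, hr]
    have h1 := norm_sub_le h (τ h • 1)
    have h2 := τ.norm_le h
    rw [norm_smul] at h1
    have h3 := mul_le_mul (h2.trans hn) (norm_one_le (M := M)) (norm_nonneg _) zero_le_one
    linarith
  have hb0 : τ ((1 / 16 : ℂ) • (h - τ h • 1)) = 0 := by
    rw [map_smul', map_sub, map_smul_one, sub_self, mul_zero]
  obtain ⟨w, hw, h1, h2, h3⟩ := τ.exists_cayley hb hbn hb0
  have hle : (τ.norm2 (a - τ a • 1) / 32) ^ 2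
      ≤ τ.norm2 ((1 / 16 : ℂ) • (h - τ h • 1)) ^ 2 := by
    rw [norm2_smul, hr]
    refine pow_le_pow_left₀ (div_nonneg (τ.norm2_nonneg _) (by norm_num)) ?_ 2
    linarith
  refine ⟨w, hw, by linarith, by linarith, fun x => ?_⟩
  have h4 := h3 x
  rw [norm2_comm_smul, norm2_comm_sub_smul_one, hr] at h4
  have h5 := hc x
  have h6 := τ.norm2_nonneg (x * h - h * x)
  linarith

end Trace

/-- Uniformly nontrivial contractions that almost commute with any given finite set. -/
def HasUniformlyNontrivialCentralElements (τ : Trace M) : Prop :=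
  ∃ c > 0, ∀ F : Finset M.toStarSubalgebra, ∀ ε > 0, ∃ a, ‖a‖ ≤ 1 ∧
    c ≤ τ.norm2 (a - τ a • 1) ∧ ∀ x ∈ F, τ.norm2 (x * a - a * x) < ε

namespace HasUniformlyNontrivialCentralElements

variable {τ : Trace M}

/-- The Cayley construction converts the uniform variance bound c into ρ = 1 - (c / 32)². The bound
on the square of w is carried along for the final perturbation to trace zero. -/
theorem exists_unitary (h : HasUniformlyNontrivialCentralElements τ) :
    ∃ ρ : ℝ, 0 ≤ ρ ∧ ρ < 1 ∧ ∀ F : Finset M.toStarSubalgebra, ∀ ε > 0,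
      ∃ w ∈ unitary M.toStarSubalgebra, ‖τ w‖ ≤ ρ ∧ ‖τ (w * w)‖ ≤ ρ ∧
        ∀ x ∈ F, τ.norm2 (x * w - w * x) < ε := by
  classical
  obtain ⟨c, hc, h⟩ := h
  have key : ∀ F : Finset M.toStarSubalgebra, ∀ ε > 0,
      ∃ w ∈ unitary M.toStarSubalgebra, ‖τ w‖ ≤ 1 - (c / 32) ^ 2 ∧
        ‖τ (w * w)‖ ≤ 1 - (c / 32) ^ 2 ∧ ∀ x ∈ F, τ.norm2 (x * w - w * x) < ε := by
    intro F ε hε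
    -- Passing to a self-adjoint part brings in commutators with adjoints, hence the enlarged set
    -- and the halved ε.
    obtain ⟨a, ha, hac, haF⟩ := h (F ∪ F.image star) (ε / 2) (by positivity)
    obtain ⟨w, hw, h1, h2, h3⟩ := τ.exists_unitary_of_contraction ha
    have hle : (c / 32) ^ 2 ≤ (τ.norm2 (a - τ a • 1) / 32) ^ 2 :=
      pow_le_pow_left₀ (by positivity) (by linarith) 2
    refine ⟨w, hw, by linarith, by linarith, fun x hx => ?_⟩
    have h4 := haF x (Finset.mem_union_left _ hx)
    have h5 := haF (star x) (Finset.mem_union_right _ (Finset.mem_image_of_mem _ hx))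
    linarith [h3 x]
  obtain ⟨w, -, hw, -⟩ := key ∅ 1 one_pos
  exact ⟨_, (norm_nonneg _).trans hw, by simp only [sub_lt_self_iff]; positivity, key⟩

/-- In a factor the traces of the almost central unitaries and of their squares can be made small,
by taking products of almost independent unitaries. -/
theorem exists_unitary_pow
    (hM : ∀ x : M.toStarSubalgebra, (∀ g, g * x = x * g) → ∃ c : ℂ, x = c • 1)
    (h : HasUniformlyNontrivialCentralElements τ) {δ : ℝ} (hδ : 0 < δ)
    (F : Finset M.toStarSubalgebra) {ε : ℝ} (hε : 0 < ε) :
    ∃ v ∈ unitary M.toStarSubalgebra, ‖τ v‖ ≤ δ ∧ ‖τ (v * v)‖ ≤ δ ∧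
      ∀ x ∈ F, τ.norm2 (x * v - v * x) < ε := by
  classical
  obtain ⟨ρ, hρ0, hρ1, h⟩ := h.exists_unitary
  have key : ∀ k : ℕ, ∀ F : Finset M.toStarSubalgebra, ∀ ε > 0,
      ∃ v ∈ unitary M.toStarSubalgebra, ‖τ v‖ ≤ ((1 + ρ) / 2) ^ k ∧
        ‖τ (v * v)‖ ≤ ((1 + ρ) / 2) ^ k ∧ ∀ x ∈ F, τ.norm2 (x * v - v * x) < ε := by
    intro k
    induction k with
    | zero =>
      intro F ε hε
      exact ⟨1, one_mem _, by simp [τ.map_one'], by simp [τ.map_one'],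
        fun x _ => by simpa [τ.norm2_zero] using hε⟩
    | succ k ih =>
      intro F ε hε
      obtain ⟨v, hv, hv1, hv2, hvF⟩ := ih F (ε / 2) (by positivity)
      set r := ((1 + ρ) / 2) ^ k with hr
      have hr0 : 0 < r := by positivity
      -- Two errors of size δ, from almost independence and from commuting v past w, turn `r * ρ`
      -- into exactly `r * (1 + ρ) / 2`.
      obtain ⟨δ, hδ⟩ : ∃ δ, δ = r * (1 - ρ) / 4 := ⟨_, rfl⟩
      have hδ0 : 0 < δ := by
        have : 0 < 1 - ρ := by linarith
        rw [hδ]; positivity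
      obtain ⟨G₁, η₁, hη₁, hG₁⟩ := τ.exists_finset_almost_independent hM v hδ0
      obtain ⟨G₂, η₂, hη₂, hG₂⟩ := τ.exists_finset_almost_independent hM (v * v) hδ0
      obtain ⟨w, hw, hw1, hw2, hwF⟩ := h (F ∪ G₁ ∪ G₂ ∪ {v})
        (min (ε / 2) (min η₁ (min (η₂ / 2) δ))) (by positivity)
      simp only [Finset.mem_union, Finset.mem_singleton, lt_min_iff] at hwF
      have hwn := Trace.norm_unitary_le hw
      have hvn := Trace.norm_unitary_le hv
      have hi1 := hG₁ w hwn fun g hg => (hwF g (by tauto)).2.1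
      have hi2 := hG₂ (w * w) (Trace.norm_unitary_le (mul_mem hw hw)) fun g hg => by
        have h1 := τ.norm2_comm_mul_le g w w
        have h2 := (hwF g (by tauto)).2.2.1
        have h3 := τ.norm2_nonneg (g * w - w * g)
        nlinarith
      have hvw := (hwF v (by tauto)).2.2.2
      have hprod : ∀ {p q : ℂ} {z : ℂ}, ‖z - p * q‖ < δ → ‖p‖ ≤ r → ‖q‖ ≤ ρ →
          ‖z‖ ≤ r * ρ + δ := by
        intro p q z hz hp hq
        have h1 := norm_add_le (z - p * q) (p * q)
        rw [sub_add_cancel, norm_mul] at h1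
        have h2 := mul_le_mul hp hq (norm_nonneg _) hr0.le
        linarith
      have hpow : ((1 + ρ) / 2) ^ (k + 1) = r * ρ + δ + δ := by
        rw [pow_succ, ← hr, hδ]; ring
      refine ⟨v * w, mul_mem hv hw, ?_, ?_, fun x hx => ?_⟩
      · rw [hpow]
        linarith [hprod hi1 hv1 hw1]
      -- Up to the small commutator of v and w, the square of the product is the product of the
      -- squares, to which independence of `w * w` from `v * v` applies.
      · have e : v * w * (v * w) = v * v * (w * w) - v * ((v * w - w * v) * w) := by
          noncomm_ring
        have h1 := hprod hi2 hv2 hw2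
        have h2 := τ.norm_le_norm2 (v * ((v * w - w * v) * w))
        have h3 := τ.norm2_mul_le v ((v * w - w * v) * w)
        have h4 := τ.norm2_mul_le_right (v * w - w * v) w
        have h5 := τ.norm2_nonneg (v * w - w * v)
        have h6 := τ.norm2_nonneg ((v * w - w * v) * w)
        have h7 := norm_sub_le (τ (v * v * (w * w))) (τ (v * ((v * w - w * v) * w)))
        rw [hpow, e, map_sub]
        nlinarith [norm_nonneg v, norm_nonneg w]
      · have h1 := τ.norm2_comm_mul_le x v w
        have h2 := hvF x hx
        have h3 := (hwF x (by tauto)).1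
        have h4 := τ.norm2_nonneg (x * v - v * x)
        have h5 := τ.norm2_nonneg (x * w - w * x)
        nlinarith [norm_nonneg v, norm_nonneg w]
  obtain ⟨k, hk⟩ := exists_pow_lt_of_lt_one hδ (show (1 + ρ) / 2 < 1 by linarith)
  obtain ⟨v, hv, h1, h2, h3⟩ := key k F ε hε
  exact ⟨v, hv, h1.trans hk.le, h2.trans hk.le, h3⟩

theorem hasGamma
    (hM : ∀ x : M.toStarSubalgebra, (∀ g, g * x = x * g) → ∃ c : ℂ, x = c • 1)
    (h : HasUniformlyNontrivialCentralElements τ) : HasGamma τ := by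
  classical
  intro F hF ε hε
  obtain ⟨B, hB⟩ := (hF.image fun x => ‖x‖).bddAbove
  have hB' : ∀ x ∈ F, ‖x‖ ≤ max B 1 := fun x hx =>
    (hB (Set.mem_image_of_mem _ hx)).trans (le_max_left _ _)
  have hB1 : 1 ≤ max B 1 := le_max_right _ _
  set K := max B 1
  -- Replacing v by u changes each commutator by at most `2 * K * (ε / (4 * K)) = ε / 2`, where K
  -- bounds the norms on F.
  obtain ⟨η, hη, hnear⟩ := τ.exists_trace_zero_unitary_near (ε := ε / (4 * K)) (by positivity)
  obtain ⟨v, hv, h1, h2, h3⟩ := h.exists_unitary_pow hM (δ := min η (1 / 2)) (by positivity)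
    hF.toFinset (ε := ε / 2) (by positivity)
  obtain ⟨u, hu, hu0, huv⟩ := hnear v hv (h1.trans (min_le_left _ _))
    (h2.trans (min_le_right _ _))
  refine ⟨u, hu, hu0, fun x hx => ?_⟩
  have e : u = v + (u - v) := by abel
  have h4 := τ.norm2_comm_add_le x v (u - v)
  rw [← e] at h4
  have h5 := τ.norm2_sub_le (x * (u - v)) ((u - v) * x)
  have h6 := τ.norm2_mul_le x (u - v)
  have h7 := τ.norm2_mul_le_right (u - v) x
  have h8 := τ.norm2_le_norm (u - v)
  have h9 := h3 x (hF.mem_toFinset.2 hx)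
  have h10 : ‖x‖ * τ.norm2 (u - v) ≤ K * (ε / (4 * K)) :=
    mul_le_mul (hB' x hx) (h8.trans huv.le) (τ.norm2_nonneg _) (by linarith)
  have h11 : K * (ε / (4 * K)) = ε / 4 := by field_simp
  nlinarith

end HasUniformlyNontrivialCentralElements

end

/-! ### Relative commutants in the ultrapower -/

section

variable {H : Type u} [NormedAddCommGroup H] [InnerProductSpace ℂ H] [CompleteSpace H]
variable {M : VonNeumannAlgebra H} {τ : Trace M} {U : Ultrafilter ℕ}

namespace Ultrapower

theorem mk_mul_eq_mk_mul {x y : boundedSeq M} :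
    mk τ U x * mk τ U y = mk τ U y * mk τ U x ↔
      Tendsto (fun j => τ.norm2 (x.1 j * y.1 j - y.1 j * x.1 j)) U (𝓝 0) := by
  rw [← mk_mul, ← mk_mul, mk_eq_mk]
  rfl

theorem mk_eq_algebraMap {x : boundedSeq M} {c : ℂ} :
    mk τ U x = algebraMap ℂ (Ultrapower τ U) c ↔
      Tendsto (fun j => τ.norm2 (x.1 j - c • 1)) U (𝓝 0) := by
  rw [← AlgHom.commutes (mk τ U) c, mk_eq_mk]
  have e : ∀ j, (algebraMap ℂ (boundedSeq M) c).1 j = c • (1 : M.toStarSubalgebra) := fun j =>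
    Algebra.algebraMap_eq_smul_one c
  simp only [e]

/-- A scalar of trace zero is 0, which is not unitary because the ultrapower is not the zero ring.
-/
theorem ContainsTraceZeroUnitary.isNontrivial {S : Set (Ultrapower τ U)}
    (h : ContainsTraceZeroUnitary S) : IsNontrivial S := by
  obtain ⟨u, huS, hu, hu0⟩ := h
  refine ⟨u, huS, fun c hc => ?_⟩
  obtain ⟨x, rfl⟩ := mk_surjective τ U u
  have h1 := trace_mk τ U x
  rw [hu0] at h1
  have h2 := mk_eq_algebraMap.1 hc
  have h3 : Tendsto (fun j => τ (x.1 j - c • 1)) U (𝓝 0) :=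
    squeeze_zero_norm (fun j => τ.norm_le_norm2 _) h2
  simp only [map_sub, τ.map_smul_one] at h3
  have h4 : (0 : ℂ) - c = 0 := tendsto_nhds_unique (h1.sub_const c) h3
  have h5 : c = 0 := by simpa using h4
  rw [h5, map_zero] at hc
  have h6 := (Unitary.mem_iff.1 hu).1
  rw [hc, mul_zero, ← map_zero (mk τ U), ← map_one (mk τ U), mk_eq_mk] at h6
  have h7 : (fun j => τ.norm2 ((0 : boundedSeq M).1 j - (1 : boundedSeq M).1 j)) = fun _ => 1 := by
    funext j
    change τ.norm2 (0 - 1) = 1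
    rw [zero_sub, τ.norm2_neg, τ.norm2_one]
  rw [h7] at h6
  exact one_ne_zero (tendsto_nhds_unique tendsto_const_nhds h6)

/-- Diagonal argument: at index j, Γ is applied to the j-th entries of the first j + 1 representing
sequences, with tolerance 1 / (j + 1). Freeness of the ultrafilter makes each fixed k eventually at
most j and the tolerances tend to 0. -/
theorem containsTraceZeroUnitary_centralizer_of_countable (h : HasGamma τ)
    (hU : ∀ n : ℕ, U ≠ pure n) {S : Set (Ultrapower τ U)} (hS : S.Countable) :
    ContainsTraceZeroUnitary (Set.centralizer S) := by
  have hfree : (U : Filter ℕ) ≤ atTop := by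
    rw [← Nat.cofinite_eq_atTop]
    exact U.le_cofinite_or_eq_pure.resolve_right fun ⟨n, hn⟩ => hU n hn
  -- Inserting 0 only ensures that there is something to enumerate when S is empty.
  obtain ⟨s, hs⟩ := (hS.insert 0).exists_eq_range (Set.insert_nonempty _ _)
  choose x hx using fun k => mk_surjective τ U (s k)
  have hΓ : ∀ j : ℕ, ∃ u ∈ unitary M.toStarSubalgebra, τ u = 0 ∧
      ∀ k ≤ j, τ.norm2 ((x k).1 j * u - u * (x k).1 j) < 1 / ((j : ℝ) + 1) := by
    intro j
    obtain ⟨u, hu, hu0, huF⟩ := h ((fun k => (x k).1 j) '' Set.Iic j)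
      ((Set.finite_Iic j).image _) (1 / ((j : ℝ) + 1)) (by positivity)
    exact ⟨u, hu, hu0, fun k hk => huF _ (Set.mem_image_of_mem _ hk)⟩
  choose u hu hu0 huc using hΓ
  let v : boundedSeq M := ⟨u, 1, fun j => Trace.norm_unitary_le (hu j)⟩
  refine ⟨mk τ U v, ?_, ?_, ?_⟩
  · intro y hy
    obtain ⟨k, rfl⟩ : y ∈ Set.range s := hs ▸ Set.mem_insert_of_mem _ hy
    rw [← hx k]
    refine mk_mul_eq_mk_mul.2 (squeeze_zero' (Eventually.of_forall fun j => τ.norm2_nonneg _) ?_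
      (tendsto_one_div_add_atTop_nhds_zero_nat.mono_left hfree))
    exact hfree ((eventually_ge_atTop k).mono fun j hj => (huc j k hj).le)
  · have h1 : star v * v = 1 := Subtype.ext (funext fun j => (Unitary.mem_iff.1 (hu j)).1)
    have h2 : v * star v = 1 := Subtype.ext (funext fun j => (Unitary.mem_iff.1 (hu j)).2)
    refine Unitary.mem_iff.2 ⟨?_, ?_⟩
    · rw [star_mk, ← mk_mul, h1, map_one]
    · rw [star_mk, ← mk_mul, h2, map_one]
  · refine tendsto_nhds_unique (trace_mk τ U v) ?_
    have e : (fun j => τ (v.1 j)) = fun _ => 0 := funext hu0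
    rw [e]
    exact tendsto_const_nhds

end Ultrapower

/-! ### Uniformity when a finite set has trivial relative commutant in M -/

open Ultrapower

/-- Asymptotic commutation with G₀ alone forces the weak limit of the unitaries to be a scalar. This
gives independence from every z, although the sequence need not asymptotically commute with z. -/
theorem exists_asymptotically_independent_unitaries {G₀ : Finset M.toStarSubalgebra}
    (hG₀ : ∀ x : M.toStarSubalgebra, (∀ g ∈ G₀, g * x = x * g) → ∃ c : ℂ, x = c • 1)
    (h : ∀ F : Set M.toStarSubalgebra, F.Finite →
      IsNontrivial (Set.centralizer (const τ U '' F))) (F : Finset M.toStarSubalgebra) :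
    ∃ t : ℝ, 0 ≤ t ∧ t < 1 ∧ ∃ w : ℕ → M.toStarSubalgebra,
      (∀ j, w j ∈ unitary M.toStarSubalgebra) ∧ (∀ᶠ j in U, ‖τ (w j)‖ ≤ t) ∧
      (∀ x ∈ F, Tendsto (fun j => τ.norm2 (x * w j - w j * x)) U (𝓝 0)) ∧
      ∀ z, Tendsto (fun j => τ (z * w j) - τ z * τ (w j)) U (𝓝 0) := by
  classical
  obtain ⟨G, hG⟩ : ∃ G, G = (F ∪ G₀) ∪ (F ∪ G₀).image star := ⟨_, rfl⟩
  obtain ⟨y, hy, hyc⟩ := h G G.finite_toSet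
  obtain ⟨x, rfl⟩ := mk_surjective τ U y
  obtain ⟨C, hC⟩ := x.2
  obtain ⟨K, hK⟩ : ∃ K, K = max C 1 := ⟨_, rfl⟩
  have hK1 : 1 ≤ K := hK ▸ le_max_right _ _
  have hKC : ∀ j, ‖x.1 j‖ ≤ K := fun j => (hC j).trans (hK ▸ le_max_left _ _)
  have hKn : ‖((K⁻¹ : ℝ) : ℂ)‖ = K⁻¹ := by
    rw [Complex.norm_real, Real.norm_eq_abs, abs_of_nonneg (by positivity)]
  obtain ⟨a, ha⟩ : ∃ a : ℕ → M.toStarSubalgebra, a = fun j => ((K⁻¹ : ℝ) : ℂ) • x.1 j :=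
    ⟨_, rfl⟩
  have han : ∀ j, ‖a j‖ ≤ 1 := by
    intro j
    simp only [ha]
    rw [norm_smul, hKn, inv_mul_le_iff₀ (by linarith), mul_one]
    exact hKC j
  have hcomm : ∀ g ∈ G, Tendsto (fun j => τ.norm2 (g * a j - a j * g)) U (𝓝 0) := by
    intro g hg
    have h1 := mk_mul_eq_mk_mul.1 (hy _ (Set.mem_image_of_mem _ hg))
    have h2 := h1.const_mul K⁻¹
    rw [mul_zero] at h2
    refine h2.congr fun j => ?_
    simp only [ha]
    rw [τ.norm2_comm_smul, hKn]
  -- Along an ultrafilter, failure for every κ means that the variances tend to 0, and then y equals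
  -- its trace, a scalar.
  have hvar : ∃ κ > 0, ∀ᶠ j in U, κ ≤ τ.norm2 (a j - τ (a j) • 1) := by
    by_contra hcon
    refine hyc (trace τ U (mk τ U x)) (mk_eq_algebraMap.2 ?_)
    have h1 : Tendsto (fun j => τ.norm2 (a j - τ (a j) • 1)) U (𝓝 0) := by
      refine Metric.tendsto_nhds.2 fun ε hε => ?_
      have h2 := Ultrafilter.eventually_not.2 (not_exists.1 hcon ε ∘ And.intro hε)
      filter_upwards [h2] with j hj
      rw [Real.dist_eq, sub_zero, abs_of_nonneg (τ.norm2_nonneg _)]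
      exact not_le.1 hj
    have h2 : Tendsto (fun j => ‖τ (x.1 j) - trace τ U (mk τ U x)‖) U (𝓝 0) :=
      tendsto_iff_norm_sub_tendsto_zero.1 (trace_mk τ U x)
    have h3 := (h1.const_mul K).add h2
    rw [mul_zero, add_zero] at h3
    refine squeeze_zero (fun j => τ.norm2_nonneg _) (fun j => ?_) h3
    have e1 : K * τ.norm2 (a j - τ (a j) • 1) = τ.norm2 (x.1 j - τ (x.1 j) • 1) := by
      rw [ha, τ.norm2_smul_sub_trace, hKn, ← mul_assoc, mul_inv_cancel₀ (by linarith), one_mul]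
    rw [e1]
    exact τ.norm2_sub_smul_one_le _ _ _
  obtain ⟨κ, hκ, hvar⟩ := hvar
  choose w hw hw1 _ hw3 using fun j => τ.exists_unitary_of_contraction (han j)
  have hwc : ∀ g ∈ F ∪ G₀, Tendsto (fun j => τ.norm2 (g * w j - w j * g)) U (𝓝 0) := by
    intro g hg
    have h1 := (hcomm g (hG ▸ Finset.mem_union_left _ hg)).add
      (hcomm (star g) (hG ▸ Finset.mem_union_right _ (Finset.mem_image_of_mem _ hg)))
    rw [add_zero] at h1
    exact squeeze_zero (fun j => τ.norm2_nonneg _) (fun j => hw3 j g) h1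
  have hle : ∀ᶠ j in U, ‖τ (w j)‖ ≤ 1 - (κ / 32) ^ 2 := by
    filter_upwards [hvar] with j hj
    have h1 : (κ / 32) ^ 2 ≤ (τ.norm2 (a j - τ (a j) • 1) / 32) ^ 2 :=
      pow_le_pow_left₀ (by positivity) (by linarith) 2
    linarith [hw1 j]
  obtain ⟨y, hy'⟩ := τ.exists_weak_limit U w fun j => Trace.norm_unitary_le (hw j)
  obtain ⟨c, rfl⟩ := hG₀ y fun g hg =>
    τ.commute_of_weak_limit hy' (hwc g (Finset.mem_union_right _ hg))
  refine ⟨1 - (κ / 32) ^ 2, ?_, by simp only [sub_lt_self_iff]; positivity, w, hw, hle,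
    fun g hg => hwc g (Finset.mem_union_left _ hg), τ.map_mul_sub_tendsto_zero hy'⟩
  obtain ⟨j, hj⟩ := hle.exists
  exact (norm_nonneg _).trans hj

/-- Each further factor `w j`, taken far along the ultrafilter, multiplies the trace bound by (1 +
t) / 2 and costs little in commutators with F. Once the trace is below 1/2, a unitary has squared
distance at least 3/4 from its trace, whatever t was. -/
theorem hasUniformlyNontrivialCentralElements_of_finset {G₀ : Finset M.toStarSubalgebra}
    (hG₀ : ∀ x : M.toStarSubalgebra, (∀ g ∈ G₀, g * x = x * g) → ∃ c : ℂ, x = c • 1)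
    (h : ∀ F : Set M.toStarSubalgebra, F.Finite →
      IsNontrivial (Set.centralizer (const τ U '' F))) :
    HasUniformlyNontrivialCentralElements τ := by
  refine ⟨1 / 2, by norm_num, fun F => ?_⟩
  obtain ⟨t, ht0, ht1, w, hw, hwt, hwF, hwz⟩ :=
    exists_asymptotically_independent_unitaries hG₀ h F
  have key : ∀ k : ℕ, ∀ ε > 0, ∃ v ∈ unitary M.toStarSubalgebra, ‖τ v‖ ≤ ((1 + t) / 2) ^ k ∧
      ∀ x ∈ F, τ.norm2 (x * v - v * x) < ε := by
    intro k
    induction k with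
    | zero =>
      intro ε hε
      exact ⟨1, one_mem _, by simp [τ.map_one'], fun x _ => by simpa [τ.norm2_zero] using hε⟩
    | succ k ih =>
      intro ε hε
      obtain ⟨v, hv, hv1, hvF⟩ := ih (ε / 2) (by positivity)
      set r := ((1 + t) / 2) ^ k with hr
      have hr0 : 0 < r := by positivity
      have hδ : 0 < r * ((1 - t) / 2) := mul_pos hr0 (by linarith)
      have h1 : ∀ᶠ j in U, ‖τ (v * w j) - τ v * τ (w j)‖ < r * ((1 - t) / 2) := by
        have := Metric.tendsto_nhds.1 (hwz v) _ hδ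
        simpa only [dist_zero_right] using this
      have h2 : ∀ᶠ j in U, ∀ x ∈ F, τ.norm2 (x * w j - w j * x) < ε / 2 := by
        rw [Filter.eventually_all_finset]
        exact fun x hx => (hwF x hx).eventually_lt_const (by positivity)
      obtain ⟨j, hj1, hj2, hj3⟩ := (h1.and (h2.and hwt)).exists
      refine ⟨v * w j, mul_mem hv (hw j), ?_, fun x hx => ?_⟩
      · have h3 := norm_add_le (τ (v * w j) - τ v * τ (w j)) (τ v * τ (w j))
        rw [sub_add_cancel, norm_mul] at h3
        have h4 := mul_le_mul hv1 hj3 (norm_nonneg _) hr0.le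
        rw [pow_succ, ← hr]
        linarith
      · have h3 := τ.norm2_comm_mul_le x v (w j)
        have h4 := hvF x hx
        have h5 := hj2 x hx
        have h6 := Trace.norm_unitary_le hv
        have h7 := Trace.norm_unitary_le (hw j)
        have h8 := τ.norm2_nonneg (x * v - v * x)
        have h9 := τ.norm2_nonneg (x * w j - w j * x)
        nlinarith [norm_nonneg v, norm_nonneg (w j)]
  intro ε hε
  obtain ⟨k, hk⟩ := exists_pow_lt_of_lt_one (show (0 : ℝ) < 1 / 2 by norm_num)
    (show (1 + t) / 2 < 1 by linarith)
  obtain ⟨v, hv, hv1, hvF⟩ := key k ε hε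
  refine ⟨v, Trace.norm_unitary_le hv, ?_, hvF⟩
  have h1 := τ.norm2_sub_trace_sq v
  rw [τ.norm2_unitary hv] at h1
  have h2 := norm_nonneg (τ v)
  have h3 := τ.norm2_nonneg (v - τ v • 1)
  nlinarith

end

section

variable {H : Type u} [NormedAddCommGroup H] [InnerProductSpace ℂ H] [CompleteSpace H]
variable {M : VonNeumannAlgebra H}

/-! ### Projections -/

/-- With P the projection, invariance under a and its adjoint gives P a P = a P and, after taking
adjoints, P a P = P a. -/
theorem starProjection_commute {K : Submodule ℂ H} [K.HasOrthogonalProjection] {a : H →L[ℂ] H}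
    (h : ∀ v ∈ K, a v ∈ K) (h' : ∀ v ∈ K, star a v ∈ K) :
    a * K.starProjection = K.starProjection * a := by
  have key : ∀ b : H →L[ℂ] H, (∀ v ∈ K, b v ∈ K) →
      K.starProjection * b * K.starProjection = b * K.starProjection := fun b hb =>
    ContinuousLinearMap.ext fun v => Submodule.starProjection_eq_self_iff.2
      (hb _ (K.starProjection_apply_mem v))
  have hs : star K.starProjection = K.starProjection :=
    isStarProjection_starProjection.isSelfAdjoint
  have h1 := congrArg star (key _ h')
  rw [star_mul, star_mul, star_mul, star_star, hs, ← mul_assoc] at h1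
  rw [← key a h, h1]

theorem starProjection_mem {K : Submodule ℂ H} [K.HasOrthogonalProjection]
    (h : ∀ y ∈ M.commutant, ∀ v ∈ K, y v ∈ K) : K.starProjection ∈ M :=
  mem_of_commute_commutant fun y hy =>
    starProjection_commute (h y hy) (h (star y) (star_mem hy))

/-- The projection onto the kernel of an element of `M`. -/
def kerProj (g : M.toStarSubalgebra) : M.toStarSubalgebra :=
  ⟨(g : H →L[ℂ] H).ker.starProjection, starProjection_mem fun y hy v hv => by
    have h := DFunLike.congr_fun (commute_of_mem_commutant g.2 hy) v
    have hv' : (g : H →L[ℂ] H) v = 0 := hv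
    change (g : H →L[ℂ] H) (y v) = 0
    exact h.trans ((congrArg y hv').trans (map_zero y))⟩

variable (g : M.toStarSubalgebra)

theorem isStarProjection_kerProj : IsStarProjection (kerProj g) where
  isIdempotentElem := Subtype.ext isStarProjection_starProjection.isIdempotentElem
  isSelfAdjoint := Subtype.ext isStarProjection_starProjection.isSelfAdjoint

theorem mul_kerProj : g * kerProj g = 0 :=
  Subtype.ext (ContinuousLinearMap.ext fun v =>
    (g : H →L[ℂ] H).ker.starProjection_apply_mem v)

variable {g}

theorem kerProj_mul {x : M.toStarSubalgebra} (h : g * x = 0) : kerProj g * x = x :=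
  Subtype.ext (ContinuousLinearMap.ext fun v => Submodule.starProjection_eq_self_iff.2
    (DFunLike.congr_fun (congrArg Subtype.val h) v))

theorem kerProj_commute {a : M.toStarSubalgebra} (h : a * g = g * a)
    (h' : star a * g = g * star a) : a * kerProj g = kerProj g * a := by
  have key : ∀ b : M.toStarSubalgebra, b * g = g * b → ∀ v ∈ (g : H →L[ℂ] H).ker,
      (b : H →L[ℂ] H) v ∈ (g : H →L[ℂ] H).ker := by
    intro b hb v hv
    have h1 := DFunLike.congr_fun (congrArg Subtype.val hb) v
    have hv' : (g : H →L[ℂ] H) v = 0 := hv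
    change (g : H →L[ℂ] H) ((b : H →L[ℂ] H) v) = 0
    exact h1.symm.trans ((congrArg (b : H →L[ℂ] H) hv').trans (map_zero _))
  exact Subtype.ext (starProjection_commute (key a h) (key (star a) h'))

theorem norm_one_sub_smul_star_mul_self_le {κ : ℝ} (hκ : 0 ≤ κ) (h : κ * ‖g‖ ^ 2 ≤ 1) :
    ‖1 - (κ : ℂ) • (star g * g)‖ ≤ 1 := by
  let G : H →L[ℂ] H := g
  refine ContinuousLinearMap.opNorm_le_bound
    ((1 - (κ : ℂ) • (star g * g) : M.toStarSubalgebra) : H →L[ℂ] H) zero_le_one fun v => ?_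
  change ‖v - (κ : ℂ) • (star G) (G v)‖ ≤ 1 * ‖v‖
  have h1 : ‖star G (G v)‖ ≤ ‖g‖ * ‖G v‖ := by
    have h2 := (star G).le_opNorm (G v)
    rwa [_root_.norm_star] at h2
  have h2 := norm_sub_sq (𝕜 := ℂ) v ((κ : ℂ) • (star G) (G v))
  have h3 : inner ℂ v ((κ : ℂ) • (star G) (G v)) = ((κ * ‖G v‖ ^ 2 : ℝ) : ℂ) := by
    rw [inner_smul_right, ContinuousLinearMap.star_eq_adjoint,
      ContinuousLinearMap.adjoint_inner_right, inner_self_eq_norm_sq_to_K]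
    push_cast
    rfl
  rw [h3, norm_smul, Complex.norm_real, Real.norm_eq_abs, abs_of_nonneg hκ] at h2
  have h4 : RCLike.re ((κ * ‖G v‖ ^ 2 : ℝ) : ℂ) = κ * ‖G v‖ ^ 2 := Complex.ofReal_re _
  rw [h4] at h2
  have h5 : (κ * ‖star G (G v)‖) ^ 2 ≤ κ * ‖G v‖ ^ 2 := by
    have h6 := pow_le_pow_left₀ (norm_nonneg _) h1 2
    have h7 := mul_le_mul_of_nonneg_left h6 (sq_nonneg κ)
    have h8 := mul_le_mul_of_nonneg_right h (mul_nonneg hκ (sq_nonneg ‖G v‖))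
    nlinarith
  have h6 : 0 ≤ κ * ‖G v‖ ^ 2 := by positivity
  rw [one_mul]
  exact (abs_le_of_sq_le_sq' (by linarith) (norm_nonneg v)).2

namespace Trace

variable (τ : Trace M)

/-- Induction on k: `star g` intertwines the two powers, so traciality matches the terms split off
from the last factor. -/
theorem map_pow_one_sub_star_mul_self (c : ℂ) (k : ℕ) :
    τ ((1 - c • (star g * g)) ^ k) = τ ((1 - c • (g * star g)) ^ k) := by
  induction k with
  | zero => simp
  | succ k ih =>
    have hs : SemiconjBy (star g) (1 - c • (g * star g)) (1 - c • (star g * g)) := by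
      simp only [SemiconjBy, mul_sub, sub_mul, mul_smul_comm, smul_mul_assoc, mul_assoc, mul_one,
        one_mul]
    have h1 := (hs.pow_right k).eq
    rw [pow_succ, pow_succ, mul_sub, mul_sub, mul_one, mul_one, map_sub, map_sub, ih,
      mul_smul_comm, mul_smul_comm, map_smul, map_smul, ← mul_assoc, ← h1, mul_assoc,
      τ.tracial', mul_assoc]

/-- Mean ergodic theorem: the contraction `1 - κ g⋆g` has fixed space ker g, so its averaged powers
converge strongly to the kernel projection, and the trace follows by normality. -/
theorem tendsto_average_kerProj {κ : ℝ} (hκ : 0 < κ) (h : κ * ‖g‖ ^ 2 ≤ 1) :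
    Tendsto (fun N : ℕ => τ ((N : ℂ)⁻¹ • ∑ k ∈ Finset.range N,
      (1 - (κ : ℂ) • (star g * g)) ^ k)) atTop (𝓝 (τ (kerProj g))) := by
  have hc := norm_one_sub_smul_star_mul_self_le hκ.le h
  obtain ⟨c, hcdef⟩ : ∃ c, c = 1 - (κ : ℂ) • (star g * g) := ⟨_, rfl⟩
  rw [← hcdef] at hc ⊢
  have hpow : ∀ k : ℕ, ‖c ^ k‖ ≤ 1 := by
    intro k
    induction k with
    | zero => simpa using norm_one_le (M := M)
    | succ k ih =>
      rw [pow_succ]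
      exact (norm_mul_le _ _).trans (mul_le_one₀ ih (norm_nonneg _) hc)
  have hnorm : ∀ N : ℕ, ‖(N : ℂ)⁻¹ • ∑ k ∈ Finset.range N, c ^ k‖ ≤ 1 := by
    intro N
    rw [norm_smul, norm_inv, Complex.norm_natCast]
    have h1 : ‖∑ k ∈ Finset.range N, c ^ k‖ ≤ N := by
      refine (norm_sum_le _ _).trans ((Finset.sum_le_sum fun k _ => hpow k).trans_eq (by simp))
    exact inv_mul_le_one_of_le₀ h1 (Nat.cast_nonneg N)
  have hlocus : (c : H →L[ℂ] H).eqLocus (1 : H →L[ℂ] H) = (g : H →L[ℂ] H).ker := by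
    ext v
    have e : (c : H →L[ℂ] H) v = v - (κ : ℂ) • star (g : H →L[ℂ] H) ((g : H →L[ℂ] H) v) := by
      rw [hcdef]; rfl
    change (c : H →L[ℂ] H) v = v ↔ (g : H →L[ℂ] H) v = 0
    rw [e, sub_eq_self, smul_eq_zero, Complex.ofReal_eq_zero]
    constructor
    · rintro (h0 | h0)
      · exact absurd h0 hκ.ne'
      · have h1 : inner ℂ v (star (g : H →L[ℂ] H) ((g : H →L[ℂ] H) v)) = 0 := by
          rw [h0, inner_zero_right]
        rwa [ContinuousLinearMap.star_eq_adjoint, ContinuousLinearMap.adjoint_inner_right,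
          inner_self_eq_zero] at h1
    · intro h0
      right
      rw [h0, map_zero]
  refine τ.tendsto_of_weak hnorm fun v w => ?_
  have hB := (c : H →L[ℂ] H).tendsto_birkhoffAverage_orthogonalProjection hc w
  have hP : (((c : H →L[ℂ] H).eqLocus (1 : H →L[ℂ] H)).orthogonalProjectionOnto w : H)
      = (kerProj g : H →L[ℂ] H) w := by
    change _ = (g : H →L[ℂ] H).ker.starProjection w
    simp only [← hlocus]
    rfl
  rw [hP] at hB
  have hB' := (tendsto_const_nhds (x := v)).inner (𝕜 := ℂ) hB
  refine hB'.congr fun N => congrArg (inner ℂ v) ?_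
  have e1 : ((((N : ℂ)⁻¹ • ∑ k ∈ Finset.range N, c ^ k : M.toStarSubalgebra)) : H →L[ℂ] H)
      = (N : ℂ)⁻¹ • ∑ k ∈ Finset.range N, (c : H →L[ℂ] H) ^ k := by
    simp
  rw [e1, birkhoffAverage, birkhoffSum]
  simp [sum_apply]

/-- The kernel projections of `g` and `g⋆` have the same trace. -/
theorem map_kerProj_star : τ (kerProj (star g)) = τ (kerProj g) := by
  have hκ : 0 < 1 / (‖g‖ ^ 2 + 1) := by positivity
  have h : 1 / (‖g‖ ^ 2 + 1) * ‖g‖ ^ 2 ≤ 1 := by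
    rw [one_div, inv_mul_le_iff₀ (by positivity)]
    linarith
  have h1 := τ.tendsto_average_kerProj hκ h
  have h2 := τ.tendsto_average_kerProj (g := star g) hκ (by rwa [norm_star])
  refine tendsto_nhds_unique h2 (h1.congr fun N => ?_)
  simp only [map_smul, map_sum, star_star, map_pow_one_sub_star_mul_self]

end Trace

/-- In a factor, `a M b = 0` only if `a = 0` or `b = 0`. -/
theorem exists_mul_mul_ne_zero
    (hM : ∀ x : M.toStarSubalgebra, (∀ g, g * x = x * g) → ∃ c : ℂ, x = c • 1)
    {a b : M.toStarSubalgebra} (ha : a ≠ 0) (hb : b ≠ 0) : ∃ x, a * x * b ≠ 0 := by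
  by_contra! hcon
  obtain ⟨S, hS⟩ : ∃ S : Set H, S = {z | ∃ (x : M.toStarSubalgebra) (v : H),
    z = (x : H →L[ℂ] H) ((b : H →L[ℂ] H) v)} := ⟨_, rfl⟩
  -- K, the closed span of M b H, is invariant under M and its commutant, so its projection is
  -- central, hence a scalar. Since b is nonzero K is everything, yet a vanishes on it.
  let K := (Submodule.span ℂ S).topologicalClosure
  have hSK : S ⊆ K := Submodule.subset_span.trans (Submodule.le_topologicalClosure _)
  have hinv : ∀ T : H →L[ℂ] H, (∀ z ∈ S, T z ∈ S) → ∀ v ∈ K, T v ∈ K := by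
    intro T hT
    have h1 : Submodule.span ℂ S ≤ (Submodule.span ℂ S).comap (T : H →ₗ[ℂ] H) :=
      Submodule.span_le.2 fun z hz => Submodule.subset_span (hT z hz)
    intro v hv
    exact map_mem_closure T.continuous hv fun z hz => h1 hz
  have hmemM : K.starProjection ∈ M := starProjection_mem fun y hy => hinv y fun z hz => by
    rw [hS] at hz ⊢
    obtain ⟨x, v, rfl⟩ := hz
    refine ⟨x, y v, ?_⟩
    have h1 := DFunLike.congr_fun (commute_of_mem_commutant x.2 hy) ((b : H →L[ℂ] H) v)
    have h2 := DFunLike.congr_fun (commute_of_mem_commutant b.2 hy) v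
    exact h1.symm.trans (congrArg (x : H →L[ℂ] H) h2.symm)
  have hinvM : ∀ m : M.toStarSubalgebra, ∀ v ∈ K, (m : H →L[ℂ] H) v ∈ K := fun m =>
    hinv m fun z hz => by
      rw [hS] at hz ⊢
      obtain ⟨x, v, rfl⟩ := hz
      exact ⟨m * x, v, rfl⟩
  obtain ⟨c, hc⟩ := hM ⟨K.starProjection, hmemM⟩ fun m =>
    Subtype.ext (starProjection_commute (hinvM m) (hinvM (star m)))
  have hc' : ∀ v, K.starProjection v = c • v := fun v =>
    DFunLike.congr_fun (congrArg Subtype.val hc) v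
  obtain ⟨v, hv⟩ : ∃ v, (b : H →L[ℂ] H) v ≠ 0 := by
    by_contra! h0
    exact hb (Subtype.ext (ContinuousLinearMap.ext h0))
  have hbv : (b : H →L[ℂ] H) v ∈ K := hSK (hS ▸ ⟨1, v, rfl⟩)
  have hc1 : c = 1 := by
    have h1 := Submodule.starProjection_eq_self_iff.2 hbv
    rw [hc'] at h1
    have h2 : (c - 1) • (b : H →L[ℂ] H) v = 0 := by rw [sub_smul, h1, one_smul, sub_self]
    exact sub_eq_zero.1 ((smul_eq_zero.1 h2).resolve_right hv)
  have hK : ∀ w, w ∈ K := fun w =>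
    Submodule.starProjection_eq_self_iff.1 (by rw [hc', hc1, one_smul])
  have haS : Submodule.span ℂ S ≤ (a : H →L[ℂ] H).ker := Submodule.span_le.2 fun z hz => by
    rw [hS] at hz
    obtain ⟨x, w, rfl⟩ := hz
    exact DFunLike.congr_fun (congrArg Subtype.val (hcon x)) w
  have haK : K ≤ (a : H →L[ℂ] H).ker :=
    Submodule.topologicalClosure_minimal _ haS (a : H →L[ℂ] H).isClosed_ker
  exact ha (Subtype.ext (ContinuousLinearMap.ext fun w => haK (hK w)))

end

/-! ### Projections in relative commutants -/

section

variable {H : Type u} [NormedAddCommGroup H] [InnerProductSpace ℂ H] [CompleteSpace H]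
variable {M : VonNeumannAlgebra H}

namespace Trace

variable (τ : Trace M)

theorem re_map_projection {q : M.toStarSubalgebra} (hq : IsStarProjection q) :
    (τ q).re = τ.norm2 q ^ 2 := by
  rw [norm2_sq, hq.isSelfAdjoint.star_eq, hq.isIdempotentElem.eq]

theorem im_map_projection {q : M.toStarSubalgebra} (hq : IsStarProjection q) :
    (τ q).im = 0 := by
  have h := τ.im_eq_zero q
  rwa [hq.isSelfAdjoint.star_eq, hq.isIdempotentElem.eq] at h

theorem re_map_projection_nonneg {q : M.toStarSubalgebra} (hq : IsStarProjection q) :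
    0 ≤ (τ q).re := by
  rw [τ.re_map_projection hq]; exact sq_nonneg _

theorem re_map_mono_projection {q r : M.toStarSubalgebra} (hq : IsStarProjection q)
    (hr : IsStarProjection r) (h : r * q = q) : (τ q).re ≤ (τ r).re := by
  have h1 := τ.re_map_projection_nonneg (hq.sub_of_mul_eq_right hr h)
  rw [map_sub, Complex.sub_re] at h1
  linarith

theorem norm_projection_le {q : M.toStarSubalgebra} (hq : IsStarProjection q) : ‖q‖ ≤ 1 := by
  have h := CStarRing.norm_star_mul_self (x := (q : H →L[ℂ] H))
  have e : star (q : H →L[ℂ] H) * (q : H →L[ℂ] H) = q := by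
    have h1 : star q * q = q := by rw [hq.isSelfAdjoint.star_eq, hq.isIdempotentElem.eq]
    exact congrArg Subtype.val h1
  rw [e] at h
  have h3 : ‖q‖ = ‖(q : H →L[ℂ] H)‖ := rfl
  rw [h3]
  nlinarith [norm_nonneg (q : H →L[ℂ] H)]

/-- A faithful trace does not vanish on nonzero positive elements. -/
theorem eq_zero_of_nonneg {x : M.toStarSubalgebra} (hx : 0 ≤ (x : H →L[ℂ] H)) (h : τ x = 0) :
    x = 0 := by
  let s : H →L[ℂ] H := CFC.sqrt (x : H →L[ℂ] H)
  have hs : s ∈ M := mem_of_commute_commutant fun y hy =>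
    ((show Commute (x : H →L[ℂ] H) y from commute_of_mem_commutant x.2 hy).cfcₙ_nnreal
      NNReal.sqrt).symm.eq
  have hss : star s * s = x := by
    rw [(IsSelfAdjoint.of_nonneg (CFC.sqrt_nonneg (x : H →L[ℂ] H))).star_eq]
    exact CFC.sqrt_mul_sqrt_self _ hx
  have e : star (⟨s, hs⟩ : M.toStarSubalgebra) * ⟨s, hs⟩ = x := Subtype.ext hss
  have h1 := τ.faithful' ⟨s, hs⟩ (by rw [e]; exact h)
  rw [← e, h1, mul_zero]

/-- The relative commutant of a finite self-adjoint set contains a nontrivial projection, once it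
contains an element that is not a scalar. -/
theorem exists_projection_of_nonscalar {G : Set M.toStarSubalgebra} (hGs : ∀ g ∈ G, star g ∈ G)
    {x : M.toStarSubalgebra} (hx : ∀ g ∈ G, g * x = x * g) (hxc : ∀ c : ℂ, x ≠ c • 1) :
    ∃ q : M.toStarSubalgebra, IsStarProjection q ∧ q ≠ 0 ∧ (τ q).re ≤ 1 / 2 ∧
      ∀ g ∈ G, g * q = q * g := by
  obtain ⟨K, hK⟩ : ∃ K, K = ‖x‖ + 1 := ⟨_, rfl⟩
  have hK0 : 0 < K := by rw [hK]; positivity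
  have hKn : ‖((K⁻¹ : ℝ) : ℂ)‖ = K⁻¹ := by
    rw [Complex.norm_real, Real.norm_eq_abs, abs_of_nonneg (by positivity)]
  have hxn : ‖((K⁻¹ : ℝ) : ℂ) • x‖ ≤ 1 := by
    rw [norm_smul, hKn, inv_mul_le_iff₀ hK0, mul_one, hK]
    linarith
  obtain ⟨h, hs, -, hv, hc⟩ := τ.exists_selfAdjoint_of_contraction hxn
  have hcomm : ∀ g ∈ G, g * h = h * g := by
    intro g hg
    have h0 : ∀ k ∈ G, τ.norm2 (k * ((K⁻¹ : ℝ) : ℂ) • x - ((K⁻¹ : ℝ) : ℂ) • x * k) = 0 := by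
      intro k hk
      rw [norm2_comm_smul, hx k hk, sub_self, norm2_zero, mul_zero]
    have h1 := hc g
    rw [h0 g hg, h0 _ (hGs g hg), add_zero] at h1
    exact sub_eq_zero.1 (τ.eq_zero_of_norm2_eq_zero (h1.antisymm (τ.norm2_nonneg _)))
  obtain ⟨c, hcdef⟩ : ∃ c, c = h - τ h • 1 := ⟨_, rfl⟩
  have hc0 : c ≠ 0 := by
    intro h0
    rw [hcdef] at h0
    rw [h0, norm2_zero, norm2_smul_sub_trace, hKn] at hv
    have h1 : τ.norm2 (x - τ x • 1) = 0 := by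
      have h2 := τ.norm2_nonneg (x - τ x • 1)
      have h3 : 0 < K⁻¹ := by positivity
      nlinarith
    exact hxc _ (sub_eq_zero.1 (τ.eq_zero_of_norm2_eq_zero h1))
  have hcτ : τ c = 0 := by rw [hcdef, map_sub, map_smul_one, sub_self]
  have hcs : star c = c := by
    rw [hcdef, star_sub, star_smul, star_one, hs, ← map_star, hs]
  have hcG : ∀ g ∈ G, g * c = c * g := by
    intro g hg
    rw [hcdef, mul_sub, sub_mul, hcomm g hg, mul_smul_comm, smul_mul_assoc, mul_one, one_mul]
  -- A nonzero self-adjoint element of trace zero has nonzero positive and negative parts, by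
  -- faithfulness. As their product is 0, the kernel projection of the positive part is neither 0
  -- nor 1.
  obtain ⟨T, hT⟩ : ∃ T : H →L[ℂ] H, T = c := ⟨_, rfl⟩
  have hTs : IsSelfAdjoint T := by rw [hT]; exact congrArg Subtype.val hcs
  have hpos : ∀ b, Commute T b → Commute T⁺ b := fun b hb => by
    rw [CFC.posPart_def]; exact hb.cfcₙ_real _
  have hneg : ∀ b, Commute T b → Commute T⁻ b := fun b hb => by
    rw [CFC.negPart_def]; exact hb.cfcₙ_real _
  have hTM : ∀ y ∈ M.commutant, Commute T y := fun y hy =>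
    hT ▸ commute_of_mem_commutant c.2 hy
  obtain ⟨p, hp⟩ : ∃ p : M.toStarSubalgebra, (p : H →L[ℂ] H) = T⁺ :=
    ⟨⟨_, mem_of_commute_commutant fun y hy => (hpos y (hTM y hy)).symm.eq⟩, rfl⟩
  obtain ⟨n, hn⟩ : ∃ n : M.toStarSubalgebra, (n : H →L[ℂ] H) = T⁻ :=
    ⟨⟨_, mem_of_commute_commutant fun y hy => (hneg y (hTM y hy)).symm.eq⟩, rfl⟩
  have hpn : c = p - n := by
    refine Subtype.ext ?_
    change (c : H →L[ℂ] H) = p - n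
    rw [hp, hn, ← hT]
    exact (CFC.posPart_sub_negPart T hTs).symm
  have hpn0 : p * n = 0 := by
    refine Subtype.ext ?_
    change (p : H →L[ℂ] H) * n = 0
    rw [hp, hn]
    exact CFC.posPart_mul_negPart T
  have hτpn : τ p = τ n := by
    rw [hpn, map_sub] at hcτ
    exact sub_eq_zero.1 hcτ
  have hp0 : p ≠ 0 := by
    intro h0
    have h1 := τ.eq_zero_of_nonneg (x := n) (hn ▸ CFC.negPart_nonneg T)
      (by rw [← hτpn, h0, map_zero])
    exact hc0 (by rw [hpn, h0, h1, sub_self])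
  have hn0 : n ≠ 0 := by
    intro h0
    have h1 := τ.eq_zero_of_nonneg (x := p) (hp ▸ CFC.posPart_nonneg T)
      (by rw [hτpn, h0, map_zero])
    exact hc0 (by rw [hpn, h0, h1, sub_self])
  have hpG : ∀ g ∈ G, g * p = p * g := by
    intro g hg
    have h1 : Commute T g := by
      rw [hT]; exact congrArg Subtype.val (hcG g hg).symm
    have h2 := (hpos g h1).symm.eq
    rw [← hp] at h2
    exact Subtype.ext h2
  have hq := isStarProjection_kerProj p
  have hqG : ∀ g ∈ G, g * kerProj p = kerProj p * g := fun g hg =>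
    kerProj_commute (hpG g hg) (hpG _ (hGs g hg))
  have hq0 : kerProj p ≠ 0 := by
    intro h0
    have h1 := kerProj_mul hpn0
    rw [h0, zero_mul] at h1
    exact hn0 h1.symm
  have hq1 : 1 - kerProj p ≠ 0 := by
    intro h0
    have h1 := mul_kerProj p
    rw [← sub_eq_zero.1 h0, mul_one] at h1
    exact hp0 h1
  by_cases hle : (τ (kerProj p)).re ≤ 1 / 2
  · exact ⟨_, hq, hq0, hle, hqG⟩
  · refine ⟨1 - kerProj p, hq.one_sub, hq1, ?_, fun g hg => ?_⟩
    · rw [map_sub, τ.map_one', Complex.sub_re, Complex.one_re]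
      linarith
    · rw [mul_sub, sub_mul, hqG g hg, mul_one, one_mul]

/-- A maximal projection of small trace in the relative commutant of a set. -/
theorem exists_maximal_projection (G : Set M.toStarSubalgebra) {t : ℝ} (ht : 0 ≤ t) :
    ∃ p : M.toStarSubalgebra, IsStarProjection p ∧ (∀ g ∈ G, g * p = p * g) ∧ (τ p).re ≤ t ∧
      ∀ p' : M.toStarSubalgebra, IsStarProjection p' → (∀ g ∈ G, g * p' = p' * g) →
        (τ p').re ≤ t → p' * p = p → p' = p := by
  -- Zorn's lemma is run on ranges. The projections of a chain converge strongly to the projection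
  -- onto the closure of the union, so commutation and, by normality, the trace bound pass to the
  -- limit.
  let 𝒮 : Set (Submodule ℂ H) := {K | ∃ q : M.toStarSubalgebra, IsStarProjection q ∧
    (q : H →L[ℂ] H).range = K ∧ (∀ g ∈ G, g * q = q * g) ∧ (τ q).re ≤ t}
  have hcoe : ∀ q : M.toStarSubalgebra, IsStarProjection q →
      IsStarProjection (q : H →L[ℂ] H) := fun q hq =>
    ⟨congrArg Subtype.val hq.isIdempotentElem, congrArg Subtype.val hq.isSelfAdjoint⟩
  have hzero : (⊥ : Submodule ℂ H) ∈ 𝒮 :=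
    ⟨0, IsStarProjection.zero _, by ext; simp, by simp, by simpa using ht⟩
  obtain ⟨K, -, hK⟩ := zorn_le_nonempty₀ 𝒮 (fun c hc hchain K₀ hK₀ => by
    have hne : Nonempty c := ⟨⟨K₀, hK₀⟩⟩
    have hdir : IsDirectedOrder c := by
      refine ⟨fun a b => ?_⟩
      rcases hchain.total a.2 b.2 with h | h
      · exact ⟨b, h, le_rfl⟩
      · exact ⟨a, le_rfl, h⟩
    choose q hq hqr hqG hqt using fun i : c => hc i.2
    have hortho : ∀ i : c, ∃ _ : (i : Submodule ℂ H).HasOrthogonalProjection,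
        (q i : H →L[ℂ] H) = (i : Submodule ℂ H).starProjection := fun i => by
      obtain ⟨K, hK, e⟩ := isStarProjection_iff_eq_starProjection.1 (hcoe _ (hq i))
      have h1 : K = i := by rw [← hqr i, e, Submodule.range_starProjection]
      subst h1
      exact ⟨hK, e⟩
    choose hortho hqs using hortho
    let P : H →L[ℂ] H := (⨆ i : c, (i : Submodule ℂ H)).topologicalClosure.starProjection
    have hlim : ∀ v, Tendsto (fun i : c => (q i : H →L[ℂ] H) v) atTop (𝓝 (P v)) := by
      intro v
      simp only [hqs]
      exact Submodule.starProjection_tendsto_closure_iSup (fun i : c => (i : Submodule ℂ H))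
        (fun _ _ h => h) v
    have hPcomm : ∀ y : H →L[ℂ] H, (∀ i, y * q i = q i * y) → y * P = P * y := by
      intro y hy
      refine ContinuousLinearMap.ext fun v => ?_
      refine tendsto_nhds_unique ((y.continuous.tendsto _).comp (hlim v)) ?_
      refine (hlim (y v)).congr fun i => ?_
      exact (DFunLike.congr_fun (hy i) v).symm
    have hPM : P ∈ M := mem_of_commute_commutant fun y hy => hPcomm y fun i =>
      (commute_of_mem_commutant (q i).2 hy).symm
    have hτ : Tendsto (fun i => τ (q i)) atTop (𝓝 (τ ⟨P, hPM⟩)) :=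
      τ.tendsto_of_weak (fun i => norm_projection_le (hq i)) fun v w =>
        tendsto_const_nhds.inner (hlim w)
    refine ⟨(⨆ i : c, (i : Submodule ℂ H)).topologicalClosure, ⟨⟨P, hPM⟩, ?_, ?_, ?_, ?_⟩, ?_⟩
    · exact ⟨Subtype.ext isStarProjection_starProjection.isIdempotentElem,
        Subtype.ext isStarProjection_starProjection.isSelfAdjoint⟩
    · exact Submodule.range_starProjection _
    · exact fun g hg => Subtype.ext (hPcomm g fun i => congrArg Subtype.val (hqG i g hg))
    · exact le_of_tendsto ((Complex.continuous_re.tendsto _).comp hτ)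
        (Eventually.of_forall hqt)
    · exact fun z hz => (le_iSup (fun i : c => (i : Submodule ℂ H)) ⟨z, hz⟩).trans
        (Submodule.le_topologicalClosure _)) ⊥ hzero
  obtain ⟨⟨p, hp, hpK, hpG, hpt⟩, hmax⟩ := hK
  refine ⟨p, hp, hpG, hpt, fun p' hp' hp'G hp't hpp' => ?_⟩
  have hle : K ≤ (p' : H →L[ℂ] H).range := by
    rw [← hpK]
    rintro _ ⟨v, rfl⟩
    exact ⟨(p : H →L[ℂ] H) v, DFunLike.congr_fun (congrArg Subtype.val hpp') v⟩
  have hge := hmax ⟨p', hp', rfl, hp'G, hp't⟩ hle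
  have h1 : p * p' = p' := by
    refine Subtype.ext (ContinuousLinearMap.ext fun v => ?_)
    obtain ⟨w, hw⟩ : (p' : H →L[ℂ] H) v ∈ (p : H →L[ℂ] H).range := by
      rw [hpK]; exact hge ⟨v, rfl⟩
    have h2 := DFunLike.congr_fun (congrArg Subtype.val hp.isIdempotentElem.eq) w
    change (p : H →L[ℂ] H) ((p' : H →L[ℂ] H) v) = (p' : H →L[ℂ] H) v
    rw [← hw]
    exact h2
  have h2 := congrArg star hpp'
  rw [star_mul, hp.isSelfAdjoint.star_eq, hp'.isSelfAdjoint.star_eq] at h2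
  rw [← h1, h2]

end Trace

end

/-! ### Left supports and maximal projections -/

section

variable {H : Type u} [NormedAddCommGroup H] [InnerProductSpace ℂ H] [CompleteSpace H]
variable {M : VonNeumannAlgebra H}

namespace Trace

variable (τ : Trace M)

theorem star_mul_self_eq_zero (τ : Trace M) {x : M.toStarSubalgebra} (h : star x * x = 0) : x = 0 :=
  τ.faithful' x (by rw [h, map_zero])

/-- A family of contractions with pairwise orthogonal ranges has square-summable `L²`-norms. -/
theorem sum_norm2_sq_le_one (T : Finset M.toStarSubalgebra) (hT : ∀ h ∈ T, ‖h‖ ≤ 1)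
    (hT' : ∀ h ∈ T, ∀ k ∈ T, h ≠ k → star h * k = 0) : ∑ h ∈ T, τ.norm2 h ^ 2 ≤ 1 := by
  obtain ⟨A, hA⟩ : ∃ A, A = ∑ h ∈ T, h * star h := ⟨_, rfl⟩
  have hAs : star A = A := by
    rw [hA, star_sum]
    exact Finset.sum_congr rfl fun h _ => by rw [star_mul, star_star]
  have hhA : ∀ h ∈ T, star h * A = star h * (h * star h) := by
    intro h hh
    rw [hA, Finset.mul_sum]
    refine Finset.sum_eq_single_of_mem h hh fun k hk hkh => ?_
    rw [← mul_assoc, hT' h hh k hk hkh.symm, zero_mul]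
  have hre : ∀ h : M.toStarSubalgebra, (τ (h * star h)).re = τ.norm2 h ^ 2 := by
    intro h
    rw [τ.tracial', norm2_sq]
  have h1 : (τ A).re = ∑ h ∈ T, τ.norm2 h ^ 2 := by
    rw [hA, map_sum, Complex.re_sum]
    exact Finset.sum_congr rfl fun h _ => hre h
  have h2 : τ.norm2 A ^ 2 ≤ ∑ h ∈ T, τ.norm2 h ^ 2 := by
    -- Orthogonality removes the cross terms. With s the sum in question, τ(A) = s and ‖A‖₂² ≤ s, so
    -- s² ≤ s.
    have e : star A * A = ∑ h ∈ T, h * star h * (h * star h) := by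
      rw [hAs]
      nth_rewrite 1 [hA]
      rw [Finset.sum_mul]
      exact Finset.sum_congr rfl fun h hh => by rw [mul_assoc, hhA h hh, mul_assoc]
    rw [norm2_sq, e, map_sum, Complex.re_sum]
    refine Finset.sum_le_sum fun h hh => ?_
    have e2 : (τ (h * star h * (h * star h))).re = τ.norm2 (h * star h) ^ 2 := by
      rw [norm2_sq, star_mul, star_star]
    rw [e2]
    have h3 := τ.norm2_mul_le h (star h)
    rw [norm2_star] at h3
    have h4 := τ.norm2_nonneg h
    have h5 := τ.norm2_nonneg (h * star h)
    have h6 := hT h hh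
    exact pow_le_pow_left₀ h5 (by nlinarith) 2
  have h3 := (Complex.re_le_norm _).trans (τ.norm_le_norm2 A)
  have h4 := τ.norm2_nonneg A
  rw [h1] at h3
  have h5 : 0 ≤ ∑ h ∈ T, τ.norm2 h ^ 2 := Finset.sum_nonneg fun h _ => sq_nonneg _
  by_contra! hlt
  nlinarith

/-- A summable family of nonzero terms is countable. This is what makes one element suffice for the
whole family although M need not be separable. -/
theorem countable_of_pairwise_orthogonal (τ : Trace M) {S : Set M.toStarSubalgebra}
    (hS : ∀ h ∈ S, h ≠ 0 ∧ ‖h‖ ≤ 1) (hS' : ∀ h ∈ S, ∀ k ∈ S, h ≠ k → star h * k = 0) :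
    S.Countable := by
  classical
  have hsum : Summable fun h : S => τ.norm2 h ^ 2 := by
    refine summable_of_sum_le (fun h => sq_nonneg _) (c := 1) fun T => ?_
    have h1 := τ.sum_norm2_sq_le_one (T.map (Function.Embedding.subtype _))
      (fun h hh => by
        obtain ⟨k, -, rfl⟩ := Finset.mem_map.1 hh
        exact (hS k k.2).2)
      (fun h hh k hk hne => by
        obtain ⟨h, -, rfl⟩ := Finset.mem_map.1 hh
        obtain ⟨k, -, rfl⟩ := Finset.mem_map.1 hk
        exact hS' h h.2 k k.2 hne)
    rwa [Finset.sum_map] at h1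
  have hsupp : Function.support (fun h : S => τ.norm2 h ^ 2) = Set.univ := by
    refine Set.eq_univ_of_forall fun h => ?_
    exact pow_ne_zero 2 fun h0 => (hS h h.2).1 (τ.eq_zero_of_norm2_eq_zero h0)
  have h1 := hsum.countable_support
  rw [hsupp] at h1
  exact Set.countable_coe_iff.1 (Set.countable_univ_iff.1 h1)

/-- A countable family of contractions with pairwise orthogonal ranges and coranges is encoded in
a single element. -/
theorem exists_sum_of_countable {S : Set M.toStarSubalgebra} (hSc : S.Countable)
    (hS : ∀ h ∈ S, ‖h‖ ≤ 1)
    (hS' : ∀ h ∈ S, ∀ k ∈ S, h ≠ k → star h * k = 0 ∧ h * star k = 0) :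
    ∃ g : M.toStarSubalgebra,
      (∀ a, (∀ h ∈ S, a * h = 0) → a * g = 0) ∧ (∀ a, (∀ h ∈ S, h * a = 0) → g * a = 0) ∧
      ∀ h ∈ S, ∃ c : ℂ, c ≠ 0 ∧ star h * g = c • (star h * h) ∧ g * star h = c • (h * star h) := by
  have := hSc.to_subtype
  let _ := Encodable.ofCountable S
  -- Geometric weights make the sum converge in norm; being nonzero, they lose no support.
  let f : S → M.toStarSubalgebra := fun h => ((1 / 2 : ℂ) ^ Encodable.encode h) • (h : _)
  have hf : Summable f := by
    refine Summable.of_norm_bounded (g := fun h : S => (1 / 2 : ℝ) ^ Encodable.encode h)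
      summable_geometric_two_encode fun h => ?_
    have h1 : ‖(1 / 2 : ℂ)‖ = 1 / 2 := by simp
    simp only [f]
    rw [norm_smul, norm_pow, h1]
    exact mul_le_of_le_one_right (by positivity) (hS h h.2)
  refine ⟨∑' h, f h, fun a ha => ?_, fun a ha => ?_, fun h hh => ?_⟩
  · rw [← hf.tsum_mul_left]
    refine (tsum_congr fun h => ?_).trans tsum_zero
    simp only [f]
    rw [mul_smul_comm, ha h h.2, smul_zero]
  · rw [← hf.tsum_mul_right]
    refine (tsum_congr fun h => ?_).trans tsum_zero
    simp only [f]
    rw [smul_mul_assoc, ha h h.2, smul_zero]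
  · refine ⟨(1 / 2 : ℂ) ^ Encodable.encode (⟨h, hh⟩ : S), pow_ne_zero _ (by norm_num), ?_, ?_⟩
    · rw [← hf.tsum_mul_left, tsum_eq_single (⟨h, hh⟩ : S)]
      · simp only [f, mul_smul_comm]
      · intro k hk
        simp only [f]
        rw [mul_smul_comm, (hS' h hh k k.2 fun e => hk (Subtype.ext e.symm)).1, smul_zero]
    · rw [← hf.tsum_mul_right, tsum_eq_single (⟨h, hh⟩ : S)]
      · simp only [f, smul_mul_assoc]
      · intro k hk
        simp only [f]
        rw [smul_mul_assoc, (hS' k k.2 h hh fun e => hk (Subtype.ext e)).2, smul_zero]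

/-- In a factor, a projection `p` with `τ(p) < 1/2` is the left support of an element of
`p M (1 - p)`. -/
theorem exists_left_support
    (hM : ∀ x : M.toStarSubalgebra, (∀ g, g * x = x * g) → ∃ c : ℂ, x = c • 1)
    {p : M.toStarSubalgebra} (hp : IsStarProjection p) (hpt : (τ p).re < 1 / 2) :
    ∃ g : M.toStarSubalgebra, g * p = 0 ∧ ∀ x, x * g = 0 → x * p = 0 := by
  -- Exhaustion by nonzero contractions in p M (1 - p) with pairwise orthogonal ranges and coranges.
  let 𝒯 : Set (Set M.toStarSubalgebra) := {S |
    (∀ h ∈ S, (h ≠ 0 ∧ ‖h‖ ≤ 1) ∧ (1 - p) * h = 0 ∧ h * p = 0) ∧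
    ∀ h ∈ S, ∀ k ∈ S, h ≠ k → star h * k = 0 ∧ h * star k = 0}
  obtain ⟨S, ⟨hS, hS'⟩, hmax⟩ := zorn_subset 𝒯 fun c hc hchain => by
    refine ⟨⋃₀ c, ⟨?_, ?_⟩, fun s hs => Set.subset_sUnion_of_mem hs⟩
    · rintro h ⟨s, hs, hh⟩
      exact (hc hs).1 h hh
    · rintro h ⟨s, hs, hh⟩ k ⟨s', hs', hk⟩ hne
      rcases hchain.total hs hs' with hss | hss
      · exact (hc hs').2 h (hss hh) k hk hne
      · exact (hc hs).2 h hh k (hss hk) hne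
  have hSc := τ.countable_of_pairwise_orthogonal (fun h hh => (hS h hh).1)
    fun h hh k hk hne => (hS' h hh k hk hne).1
  obtain ⟨g, hg1, hg2, hg3⟩ := exists_sum_of_countable hSc (fun h hh => (hS h hh).1.2) hS'
  have hps : star p = p := hp.isSelfAdjoint.star_eq
  have hfs : star (1 - p) = 1 - p := by rw [star_sub, star_one, hps]
  have hfg : (1 - p) * g = 0 := hg1 _ fun h hh => (hS h hh).2.1
  have hgp : g * p = 0 := hg2 _ fun h hh => (hS h hh).2.2
  have hgf : star g * (1 - p) = 0 := by
    have h := congrArg star hfg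
    rwa [star_mul, hfs, star_zero] at h
  obtain ⟨P, hP⟩ : ∃ P, P = kerProj (star g) := ⟨_, rfl⟩
  obtain ⟨Q, hQ⟩ : ∃ Q, Q = kerProj g := ⟨_, rfl⟩
  have hPp : IsStarProjection P := hP ▸ isStarProjection_kerProj _
  have hQp : IsStarProjection Q := hQ ▸ isStarProjection_kerProj _
  have hPf : P * (1 - p) = 1 - p := hP ▸ kerProj_mul hgf
  have hQq : Q * p = p := hQ ▸ kerProj_mul hgp
  have hgP : star g * P = 0 := hP ▸ mul_kerProj _
  have hgQ : g * Q = 0 := hQ ▸ mul_kerProj _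
  have hp' := hp.one_sub.sub_of_mul_eq_right hPp hPf
  have hq' := hp.sub_of_mul_eq_right hQp hQq
  -- `P - (1 - p)` is the part of p missed by the left support of g, and `Q - p` the part of 1 - p
  -- missed by its right support. Equality of the two kernel traces and τ(p) < 1/2 force the second
  -- to be nonzero.
  have hτ : (τ (Q - p)).re = (τ (P - (1 - p))).re + (1 - 2 * (τ p).re) := by
    have h1 : τ P = τ Q := hP ▸ hQ ▸ τ.map_kerProj_star
    simp only [map_sub, Complex.sub_re, h1, τ.map_one', Complex.one_re]
    ring
  refine ⟨g, hgp, ?_⟩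
  by_cases h0 : P - (1 - p) = 0
  · intro x hx
    have h1 : star g * star x = 0 := by
      have h := congrArg star hx
      rwa [star_mul, star_zero] at h
    have h2 : P * star x = star x := hP ▸ kerProj_mul h1
    rw [sub_eq_zero.1 h0, sub_mul, one_mul, sub_eq_self] at h2
    have h := congrArg star h2
    rwa [star_mul, star_star, hps, star_zero] at h
  · exfalso
    have hq0 : Q - p ≠ 0 := by
      intro h1
      rw [h1, map_zero, Complex.zero_re] at hτ
      have := τ.re_map_projection_nonneg hp'
      linarith
    -- If both missed parts were nonzero, the factor property would supply an element between them,
    -- orthogonal to the family, against maximality.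
    obtain ⟨x, hx⟩ := exists_mul_mul_ne_zero hM h0 hq0
    obtain ⟨y, hy⟩ : ∃ y, y = (P - (1 - p)) * x * (Q - p) := ⟨_, rfl⟩
    rw [← hy] at hx
    obtain ⟨z, hz⟩ : ∃ z : M.toStarSubalgebra, z = ((‖y‖⁻¹ : ℝ) : ℂ) • y := ⟨_, rfl⟩
    have hyn : ‖y‖ ≠ 0 := fun h => hx (norm_eq_zero.1 h)
    have hz0 : z ≠ 0 := by
      rw [hz]
      exact smul_ne_zero (Complex.ofReal_ne_zero.2 (inv_ne_zero hyn)) hx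
    have hzn : ‖z‖ ≤ 1 := by
      rw [hz, norm_smul, Complex.norm_real, Real.norm_eq_abs, abs_of_nonneg (by positivity),
        inv_mul_cancel₀ hyn]
    have hfP : (1 - p) * P = 1 - p := by
      have h := congrArg star hPf
      rwa [star_mul, hfs, hPp.isSelfAdjoint.star_eq] at h
    have hf : (1 - p) * (P - (1 - p)) = 0 := by
      rw [mul_sub, hfP, hp.one_sub.isIdempotentElem.eq, sub_self]
    have hp0 : (Q - p) * p = 0 := by rw [sub_mul, hQq, hp.isIdempotentElem.eq, sub_self]
    have hfz : (1 - p) * z = 0 := by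
      rw [hz, mul_smul_comm, hy, mul_assoc (P - (1 - p)), ← mul_assoc (1 - p), hf, zero_mul,
        smul_zero]
    have hzp : z * p = 0 := by
      rw [hz, smul_mul_assoc, hy, mul_assoc _ (Q - p), hp0, mul_zero, smul_zero]
    have hhP : ∀ h ∈ S, star h * (P - (1 - p)) = 0 := by
      intro h hh
      obtain ⟨c, hc, -, hc2⟩ := hg3 h hh
      have h1 := congrArg star hc2
      rw [star_mul, star_star, star_smul, star_mul, star_star] at h1
      have h2 : h * (star h * P) = 0 := by
        have h3 : h * star g * P = 0 := by rw [mul_assoc, hgP, mul_zero]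
        rw [h1, smul_mul_assoc, mul_assoc] at h3
        exact (smul_eq_zero.1 h3).resolve_left (star_ne_zero.2 hc)
      have h3 : star h * P = 0 := τ.star_mul_self_eq_zero (by
        rw [star_mul, star_star, mul_assoc, h2, mul_zero])
      have h4 : star h * (1 - p) = 0 := by
        have h5 := congrArg star (hS h hh).2.1
        rwa [star_mul, hfs, star_zero] at h5
      rw [mul_sub, h3, h4, sub_self]
    have hhQ : ∀ h ∈ S, h * (Q - p) = 0 := by
      intro h hh
      obtain ⟨c, hc, hc1, -⟩ := hg3 h hh
      have h2 : star h * (h * Q) = 0 := by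
        have h3 : star h * g * Q = 0 := by rw [mul_assoc, hgQ, mul_zero]
        rw [hc1, smul_mul_assoc, mul_assoc] at h3
        exact (smul_eq_zero.1 h3).resolve_left hc
      have h3 : h * Q = 0 := τ.star_mul_self_eq_zero (by
        rw [star_mul, mul_assoc, h2, mul_zero])
      rw [mul_sub, h3, (hS h hh).2.2, sub_self]
    have hz1 : ∀ h ∈ S, star h * z = 0 := by
      intro h hh
      rw [hz, mul_smul_comm, hy, mul_assoc (P - (1 - p)), ← mul_assoc (star h), hhP h hh,
        zero_mul, smul_zero]
    have hz2 : ∀ h ∈ S, h * star z = 0 := by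
      intro h hh
      rw [hz, star_smul, mul_smul_comm, hy, star_mul, hq'.isSelfAdjoint.star_eq, ← mul_assoc,
        hhQ h hh, zero_mul, smul_zero]
    have hzS : z ∈ S := by
      refine hmax (y := insert z S) ⟨?_, ?_⟩ (Set.subset_insert _ _) (Set.mem_insert _ _)
      · rintro h (rfl | hh)
        · exact ⟨⟨hz0, hzn⟩, hfz, hzp⟩
        · exact hS h hh
      · rintro h (rfl | hh) k (rfl | hk) hne
        · exact absurd rfl hne
        · have h1 := congrArg star (hz1 k hk)
          have h2 := congrArg star (hz2 k hk)
          rw [star_mul, star_star, star_zero] at h1 h2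
          exact ⟨h1, h2⟩
        · exact ⟨hz1 h hh, hz2 h hh⟩
        · exact hS' h hh k hk hne
    exact hz0 (τ.star_mul_self_eq_zero (hz1 z hzS))

end Trace

/-- If no finite subset of a factor has trivial relative commutant, then relative commutants of
finite sets contain projections whose trace is bounded away from `0` and `1`. -/
theorem hasUniformlyNontrivialCentralElements_of_forall_finset (τ : Trace M)
    (hM : ∀ x : M.toStarSubalgebra, (∀ g, g * x = x * g) → ∃ c : ℂ, x = c • 1)
    (h : ∀ G : Finset M.toStarSubalgebra, ∃ x : M.toStarSubalgebra, (∀ g ∈ G, g * x = x * g) ∧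
      ∀ c : ℂ, x ≠ c • 1) : HasUniformlyNontrivialCentralElements τ := by
  classical
  refine ⟨1 / 4, by norm_num, fun F ε hε => ?_⟩
  suffices hs : ∃ e : M.toStarSubalgebra, IsStarProjection e ∧ (∀ x ∈ F, x * e = e * x) ∧
      1 / 4 ≤ (τ e).re ∧ (τ e).re ≤ 3 / 4 by
    obtain ⟨e, he, heF, h1, h2⟩ := hs
    refine ⟨e, Trace.norm_projection_le he, ?_, fun x hx => ?_⟩
    · have h3 := τ.norm2_sub_trace_sq e
      have h4 := τ.norm2_nonneg (e - τ e • 1)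
      rw [Complex.sq_norm, Complex.normSq_apply, τ.im_map_projection he,
        ← τ.re_map_projection he] at h3
      nlinarith
    · rw [heF x hx, sub_self, τ.norm2_zero]
      exact hε
  obtain ⟨F', hF'⟩ : ∃ F', F' = F ∪ F.image star := ⟨_, rfl⟩
  obtain ⟨p, hp, hpF, hpt, hpmax⟩ :=
    τ.exists_maximal_projection (F' : Set M.toStarSubalgebra) (t := 1 / 4) (by norm_num)
  obtain ⟨g, hgp, hg⟩ := τ.exists_left_support hM hp (by linarith)
  obtain ⟨G, hG⟩ : ∃ G, G = F' ∪ {p, g} := ⟨_, rfl⟩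
  obtain ⟨x, hx, hxc⟩ := h (G ∪ G.image star)
  obtain ⟨q, hq, hq0, hqt, hqG⟩ := τ.exists_projection_of_nonscalar
    (G := ((G ∪ G.image star : Finset M.toStarSubalgebra) : Set M.toStarSubalgebra))
    (by
      intro k hk
      rw [Finset.mem_coe, Finset.mem_union] at hk ⊢
      rcases hk with hk | hk
      · exact Or.inr (Finset.mem_image_of_mem _ hk)
      · obtain ⟨m, hm, rfl⟩ := Finset.mem_image.1 hk
        rw [star_star]
        exact Or.inl hm)
    hx hxc
  have hqG' : ∀ k ∈ G, k * q = q * k := fun k hk => hqG k (by simp [hk])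
  have hpq : p * q = q * p := hqG' p (by simp [hG])
  have hgq : g * q = q * g := hqG' g (by simp [hG])
  have hqF : ∀ k ∈ F', k * q = q * k := fun k hk => hqG' k (by simp [hG, hk])
  have hqp' : q * (1 - p) = (1 - p) * q := by rw [mul_sub, sub_mul, mul_one, one_mul, hpq]
  have hr : IsStarProjection (q * (1 - p)) := hq.mul hp.one_sub hqp'
  have hr0 : q * (1 - p) ≠ 0 := by
    -- If q lay under p, then `g * p = 0` would give `q * g = g * q = 0`, and the left support
    -- property of g would give `q * p = 0`, so q = 0.
    intro h0
    rw [mul_sub, mul_one, sub_eq_zero] at h0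
    have h1 : q * g = 0 := by rw [← hgq, h0, ← hpq, ← mul_assoc, hgp, zero_mul]
    exact hq0 (h0.trans (hg q h1))
  have hpr : p * (q * (1 - p)) = 0 := by
    rw [← mul_assoc, hpq, mul_assoc, mul_sub, mul_one, hp.isIdempotentElem.eq, sub_self, mul_zero]
  have hrp : q * (1 - p) * p = 0 := by
    rw [mul_assoc, sub_mul, one_mul, hp.isIdempotentElem.eq, sub_self, mul_zero]
  have he := hp.add hr hpr
  have heF : ∀ k ∈ F', k * (p + q * (1 - p)) = (p + q * (1 - p)) * k := by
    intro k hk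
    have h1 : k * (q * (1 - p)) = q * (1 - p) * k := by
      rw [← mul_assoc, hqF k hk, mul_assoc, mul_assoc, mul_sub, sub_mul, hpF k hk, mul_one,
        one_mul]
    rw [mul_add, add_mul, hpF k hk, h1]
  have hrt : (τ (q * (1 - p))).re ≤ 1 / 2 := by
    refine le_trans (τ.re_map_mono_projection hr hq ?_) hqt
    rw [← mul_assoc, hq.isIdempotentElem.eq]
  refine ⟨_, he, fun k hk => heF k (by simp [hF', hk]), ?_, ?_⟩
  · by_contra! hlt
    have h1 := hpmax _ he heF hlt.le (by
      rw [add_mul, hrp, add_zero, hp.isIdempotentElem.eq])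
    exact hr0 (by simpa using h1)
  · rw [map_add, Complex.add_re]
    linarith

end

/-! ### The dichotomy -/

section

variable {H : Type u} [NormedAddCommGroup H] [InnerProductSpace ℂ H] [CompleteSpace H]
variable {M : VonNeumannAlgebra H} {τ : Trace M} {U : Ultrafilter ℕ}

open Ultrapower

theorem IsIIOneFactor.exists_eq_smul_one (hM : IsIIOneFactor M) (x : M.toStarSubalgebra)
    (hx : ∀ g, g * x = x * g) : ∃ c : ℂ, x = c • 1 := by
  obtain ⟨c, hc⟩ := hM.center_trivial x x.2 (VonNeumannAlgebra.mem_commutant_iff.2 fun g hg =>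
    congrArg Subtype.val (hx ⟨g, hg⟩))
  exact ⟨c, Subtype.ext hc⟩

/-- The split is on whether some finite subset of M has trivial relative commutant in M. The
ultrapower hypothesis enters only if one does; otherwise the factor property suffices. -/
theorem hasGamma_of_isNontrivial_centralizer (hM : IsIIOneFactor M)
    (h : ∀ F : Set M.toStarSubalgebra, F.Finite →
      IsNontrivial (Set.centralizer (const τ U '' F))) : HasGamma τ := by
  by_cases hfin : ∃ G₀ : Finset M.toStarSubalgebra,
      ∀ x : M.toStarSubalgebra, (∀ g ∈ G₀, g * x = x * g) → ∃ c : ℂ, x = c • 1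
  · obtain ⟨G₀, hG₀⟩ := hfin
    exact (hasUniformlyNontrivialCentralElements_of_finset hG₀ h).hasGamma hM.exists_eq_smul_one
  · push Not at hfin
    exact (hasUniformlyNontrivialCentralElements_of_forall_finset τ hM.exists_eq_smul_one
      hfin).hasGamma hM.exists_eq_smul_one

end

end IIOne

end

open IIOne IIOne.Ultrapower in
theorem proposition3p6 {H : Type*} [NormedAddCommGroup H] [InnerProductSpace ℂ H]
    [CompleteSpace H] (M : VonNeumannAlgebra H) (hM : IsIIOneFactor M) (τ : Trace M)
    (U : Ultrafilter ℕ) (hU : ∀ n : ℕ, U ≠ pure n) :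
    (HasGamma τ ↔ ∀ F : Set M.toStarSubalgebra, F.Finite →
      ContainsTraceZeroUnitary (Set.centralizer (const τ U '' F))) ∧
    (HasGamma τ ↔ ∀ F : Set M.toStarSubalgebra, F.Finite →
      IsNontrivial (Set.centralizer (const τ U '' F))) ∧
    (HasGamma τ ↔ ∀ F : Set M.toStarSubalgebra, F.Countable →
      ContainsTraceZeroUnitary (Set.centralizer (const τ U '' F))) ∧
    (HasGamma τ ↔ ∀ F : Set M.toStarSubalgebra, F.Countable →
      IsNontrivial (Set.centralizer (const τ U '' F))) ∧
    (HasGamma τ ↔ ∀ F : Set (Ultrapower τ U), F.Finite →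
      ContainsTraceZeroUnitary (Set.centralizer F)) ∧
    (HasGamma τ ↔ ∀ F : Set (Ultrapower τ U), F.Finite →
      IsNontrivial (Set.centralizer F)) ∧
    (HasGamma τ ↔ ∀ F : Set (Ultrapower τ U), F.Countable →
      ContainsTraceZeroUnitary (Set.centralizer F)) ∧
    (HasGamma τ ↔ ∀ F : Set (Ultrapower τ U), F.Countable →
      IsNontrivial (Set.centralizer F)) := by
  -- Γ gives the strongest condition and the weakest gives Γ; the other implications only restrict
  -- the sets considered or forget that the element is a trace zero unitary.
  have fwd : HasGamma τ → ∀ F : Set (Ultrapower τ U), F.Countable →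
      ContainsTraceZeroUnitary (Set.centralizer F) := fun h F hF =>
    containsTraceZeroUnitary_centralizer_of_countable h hU hF
  have bwd : (∀ F : Set M.toStarSubalgebra, F.Finite →
      IsNontrivial (Set.centralizer (const τ U '' F))) → HasGamma τ :=
    hasGamma_of_isNontrivial_centralizer hM
  refine ⟨⟨fun h F hF => ?_, fun h => bwd fun F hF => ?_⟩,
    ⟨fun h F hF => ?_, fun h => bwd fun F hF => ?_⟩,
    ⟨fun h F hF => ?_, fun h => bwd fun F hF => ?_⟩,
    ⟨fun h F hF => ?_, fun h => bwd fun F hF => ?_⟩,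
    ⟨fun h F hF => ?_, fun h => bwd fun F hF => ?_⟩,
    ⟨fun h F hF => ?_, fun h => bwd fun F hF => ?_⟩,
    ⟨fun h F hF => ?_, fun h => bwd fun F hF => ?_⟩,
    ⟨fun h F hF => ?_, fun h => bwd fun F hF => ?_⟩⟩
  · exact fwd h _ (hF.image _).countable
  · exact (h F hF).isNontrivial
  · exact (fwd h _ (hF.image _).countable).isNontrivial
  · exact h F hF
  · exact fwd h _ (hF.image _)
  · exact (h F hF.countable).isNontrivial
  · exact (fwd h _ (hF.image _)).isNontrivial
  · exact h F hF.countable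
  · exact fwd h _ hF.countable
  · exact (h _ (hF.image _)).isNontrivial
  · exact (fwd h _ hF.countable).isNontrivial
  · exact h _ (hF.image _)
  · exact fwd h _ hF
  · exact (h _ (hF.image _).countable).isNontrivial
  · exact (fwd h _ hF).isNontrivial
  · exact h _ (hF.image _).countable
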